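/- Let $a,b,c$ be positive numbers with $a<b<c$, $\lfloor c/b\rfloor\ge 2$ and $a/b\notin\mathbb Q$. Put $$c_0:=c-\lfloor c/b\rfloor b,\qquad c_1:=c-c_0-\lfloor (c-c_0)/a\rfloor a ,$$ and assume that $b-a<c_0<a$ and $0<c_1<2a-b$. Let $\mathcal S_{a,b,c}$ be the set of all $t\in\mathbb R$ for which there is a binary vector $\mathbf x=(\mathbf x(\lambda))_{\lambda\in b\mathbb Z}$, with entries in $\{0,1\}$ and $\mathbf x(0)=1$, such that $$\sum_{\lambda\in b\mathbb Z}\chi_{[0,c)}(t-\mu+\lambda)\,\mathbf x(\lambda)=1\quad\text{for all }\mu\in a\mathbb Z .$$ Then $\mathcal S_{a,b,c}\neq\emptyset$ if and only if there exist nonnegative integers $d_1,d_2$ such that (1) $c-(d_1+1)(\lfloor c/b\rfloor+1)(b-a)-(d_2+1)\lfloor c/b\rfloor(b-a)\in a\mathbb Z$; (2) $\lfloor c/b\rfloor b+(d_1+1)(b-a)<c<\lfloor c/b\rfloor b+b-(d_2+1)(b-a)$; (3) $\#E_{a,b,c}=d_1$, where, with $m=\big((d_1+d_2+1)c_1-c_0+(d_1+1)(b-a)\big)/a$,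 $E_{a,b,c}$ is the set of all integers $n\in[1,d_1+d_2+1]$ such that $$n\,(c_1-m(b-a))\in[0,\,c_0-(d_1+1)(b-a))+(a-(d_1+d_2+1)(b-a))\mathbb Z .$$ Moreover, whenever nonnegative integers $d_1,d_2$ satisfy (1)--(3), $d_1$ and $d_2$ are the numbers of holes of $\mathcal S_{a,b,c}$ (connected components of $\mathbb R\setminus\mathcal S_{a,b,c}$) contained in $[0,c_0+a-b)$ and in $[c_0,a)$ respectively. -/

import Mathlib

noncomputable section

namespace GaborABC

/-- The infinite matrix `M_{a,b,c}(t)` with entries `χ_{[0,c)}(t - μ + λ)`, `μ ∈ aℤ`, `λ ∈ bℤ`.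
For `a, b > 0` the rows `μ = m a` and the columns `λ = n b` are indexed by the integers `m`, `n`. -/
def gaborMatrix (a b c t : ℝ) : Matrix ℤ ℤ ℝ :=
  Matrix.of fun m n => (Set.Ico (0 : ℝ) c).indicator (fun _ => (1 : ℝ)) (t - m * a + n * b)

/-- Binary vectors indexed by `bℤ` (again through `n ↦ n b`) with value one at the origin. -/
def binaryVectors : Set (ℤ → ℝ) :=
  {x | (∀ n, x n = 0 ∨ x n = 1) ∧ x 0 = 1}

/-- The set `S_{a,b,c}` of all `t` for which `M_{a,b,c}(t) x = 1` (the all-ones vector) for some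
binary vector `x` with `x(0) = 1`. For `b > 0` every row of the matrix has finite support, so
the sums are finite sums. -/
def maxInvariantSet (a b c : ℝ) : Set ℝ :=
  {t | ∃ x ∈ binaryVectors, ∀ m : ℤ, ∑ᶠ n : ℤ, gaborMatrix a b c t m n * x n = 1}

/-- `c₀ = c - ⌊c/b⌋ b`. -/
def c₀ (b c : ℝ) : ℝ := c - (⌊c / b⌋ : ℝ) * b

/-- `c₁ = (c - c₀) - ⌊(c - c₀)/a⌋ a`. -/
def c₁ (a b c : ℝ) : ℝ := c - c₀ b c - (⌊(c - c₀ b c) / a⌋ : ℝ) * a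

/-- `m = ((d₁ + d₂ + 1) c₁ - c₀ + (d₁ + 1)(b - a)) / a`. -/
def mParam (a b c : ℝ) (d₁ d₂ : ℕ) : ℝ :=
  (((d₁ : ℝ) + d₂ + 1) * c₁ a b c - c₀ b c + ((d₁ : ℝ) + 1) * (b - a)) / a

/-- The set of all integers `n ∈ [1, d₁ + d₂ + 1]` with
`n (c₁ - m (b - a)) ∈ [0, c₀ - (d₁ + 1)(b - a)) + (a - (d₁ + d₂ + 1)(b - a)) ℤ`. -/
def eSet (a b c : ℝ) (d₁ d₂ : ℕ) : Set ℕ :=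
  {n | 1 ≤ n ∧ n ≤ d₁ + d₂ + 1 ∧
    ∃ k : ℤ, (n : ℝ) * (c₁ a b c - mParam a b c d₁ d₂ * (b - a))
        - (k : ℝ) * (a - ((d₁ : ℝ) + d₂ + 1) * (b - a))
      ∈ Set.Ico (0 : ℝ) (c₀ b c - ((d₁ : ℝ) + 1) * (b - a))}

/-- The three conditions on the nonnegative integers `d₁`, `d₂`. -/
def AdmissibleParams (a b c : ℝ) (d₁ d₂ : ℕ) : Prop :=
  (∃ k : ℤ, c - ((d₁ : ℝ) + 1) * ((⌊c / b⌋ : ℝ) + 1) * (b - a)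
      - ((d₂ : ℝ) + 1) * (⌊c / b⌋ : ℝ) * (b - a) = a * k) ∧
  ((⌊c / b⌋ : ℝ) * b + ((d₁ : ℝ) + 1) * (b - a) < c ∧
    c < (⌊c / b⌋ : ℝ) * b + b - ((d₂ : ℝ) + 1) * (b - a)) ∧
  (eSet a b c d₁ d₂).encard = d₁

/-- The holes of `S_{a,b,c}` contained in a set `I`: the connected components of the complement
of `S_{a,b,c}` in the real line that are contained in `I`. -/
def holesIn (a b c : ℝ) (I : Set ℝ) : Set (Set ℝ) :=
  {H | (∃ x ∈ (maxInvariantSet a b c)ᶜ, H = connectedComponentIn (maxInvariantSet a b c)ᶜ x) ∧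
    H ⊆ I}

end GaborABC

end

noncomputable section

namespace GaborABC

/-! Write γ = c₀, σ = c₁, δ = b - a, K = ⌊c/b⌋. A binary solution selects exactly one point of t +
bℤ in every window [ma, ma + c). Each selected point determines the next: the move is (K + 1)b from
[0, γ) modulo a and Kb from [γ, a), and [γ - δ, γ) is forbidden. Modulo a this is `step`, and S is
the largest a-periodic set that avoids the hole and is mapped onto itself by `step`
(`Setting.subset_maxInvariantSet`).

On S the map preserves order. It carries gaps of S along, except that the jump up at 0 opens a gap
of length δ and the jump down at γ closes one. Irrationality of a/b excludes periodic points, and a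
circle of finite length has no room for infinitely many gaps of one length, so every gap is born at
0 and dies at γ. Hence the orbit Q_n of 0 reaches γ modulo a at some time D, and modulo a the holes
are [Q_n - δ, Q_n) for 1 ≤ n ≤ D.

Let d₁ and d₂ of these Q_n lie below and above γ; one equals γ, so D = d₁ + d₂ + 1. Adding the
displacements up to time D gives (1). Collapsing the holes turns `step` into the rotation by θ = σ -
mδ of a circle of length Y = a - Dδ, and takes γ to e = γ - (d₁ + 1)δ; the order 0 < e < Y is (2),
and counting multiples of θ in [0, e) is (3) (`CircleSystem.parameters`). Conversely, holes opened
at θ, …, Dθ in that rotation give an invariant set (`exists_conjugacy`), which lies in S by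
maximality and whose orbit of 0 shows the same counts. -/

/-! ### Floors modulo a and the lift of the two-piece rotation -/

lemma floor_div_eq {a x : ℝ} (ha : 0 < a) (j : ℤ) :
    ⌊x / a⌋ = j ↔ j * a ≤ x ∧ x < (j + 1) * a := by
  rw [Int.floor_eq_iff, le_div_iff₀ ha, div_lt_iff₀ ha]

lemma floor_div_mul_le {a : ℝ} (ha : 0 < a) (x : ℝ) : ⌊x / a⌋ * a ≤ x :=
  ((floor_div_eq ha _).1 rfl).1

lemma lt_floor_div_add_one_mul {a : ℝ} (ha : 0 < a) (x : ℝ) : x < (⌊x / a⌋ + 1) * a :=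
  ((floor_div_eq ha _).1 rfl).2

lemma floor_add_mul_div {a : ℝ} (ha : 0 < a) (x : ℝ) (j : ℤ) :
    ⌊(x + j * a) / a⌋ = ⌊x / a⌋ + j := by
  rw [add_div, mul_div_cancel_right₀ _ ha.ne', Int.floor_add_intCast]

/-- The lift to the line of the piecewise rotation of the circle `ℝ / aℤ` that shifts by `σ + δ`
on `[0, γ)` and by `σ` on `[γ, a)`. -/
def step (a δ γ σ x : ℝ) : ℝ := x + σ + δ * ((⌊x / a⌋ - ⌊(x - γ) / a⌋ : ℤ) : ℝ)

/-- There is no point of `S` in `[q - ℓ, q)`. -/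
def Gap (S : Set ℝ) (ℓ q : ℝ) : Prop := ∀ s ∈ S, s < q → s < q - ℓ

/-- A nonempty set that is invariant under `step`, avoids the hole `[γ - δ, γ) + aℤ`, and on which
`step` is surjective and has no periodic points modulo `a`. -/
structure CircleSystem (a δ γ σ : ℝ) (S : Set ℝ) : Prop where
  a_pos : 0 < a
  δ_pos : 0 < δ
  δ_lt : δ < γ
  lt_a : γ < a
  nonempty : S.Nonempty
  periodic : ∀ x ∈ S, ∀ j : ℤ, x + j * a ∈ S
  avoid : ∀ x ∈ S, ∀ j : ℤ, γ - δ + j * a ≤ x → γ + j * a ≤ x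
  step_mem : ∀ x ∈ S, step a δ γ σ x ∈ S
  exists_pre : ∀ x ∈ S, ∃ y ∈ S, step a δ γ σ y = x
  right_closed : ∀ x, (∀ ε > 0, ∃ s ∈ S, x ≤ s ∧ s < x + ε) → x ∈ S
  aperiodic : ∀ (x : ℝ) (k : ℕ) (j : ℤ), 0 < k → (step a δ γ σ)^[k] x ≠ x + j * a

lemma step_add_mul {a : ℝ} (ha : 0 < a) (δ γ σ x : ℝ) (j : ℤ) :
    step a δ γ σ (x + j * a) = step a δ γ σ x + j * a := by
  unfold step
  rw [floor_add_mul_div ha, show x + j * a - γ = x - γ + j * a by ring, floor_add_mul_div ha]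
  push_cast; ring

lemma iterate_step_add_mul {a : ℝ} (ha : 0 < a) (δ γ σ : ℝ) (k : ℕ) (x : ℝ) (j : ℤ) :
    (step a δ γ σ)^[k] (x + j * a) = (step a δ γ σ)^[k] x + j * a := by
  induction k with
  | zero => rfl
  | succ k ih => rw [Function.iterate_succ_apply', Function.iterate_succ_apply', ih,
      step_add_mul ha]

/-- Only the jumps by -δ at γ + aℤ could reverse the order. If x lies below such a jump and avoids
the hole, it is more than δ away from it; further jumps cost δ < a each, at distance a from one
another. -/
lemma step_lt_step {a δ γ σ x y : ℝ} (ha : 0 < a) (hδ : 0 < δ) (hδa : δ < a)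
    (hx : ∀ j : ℤ, γ - δ + j * a ≤ x → γ + j * a ≤ x) (hxy : x < y) :
    step a δ γ σ x < step a δ γ σ y := by
  unfold step
  have h1 : ⌊x / a⌋ ≤ ⌊y / a⌋ := Int.floor_le_floor (by gcongr)
  have h2 : ⌊(x - γ) / a⌋ ≤ ⌊(y - γ) / a⌋ := Int.floor_le_floor (by gcongr)
  have hx2 := lt_floor_div_add_one_mul ha (x - γ)
  have hy2 := floor_div_mul_le ha (y - γ)
  have hxx : x < γ - δ + (⌊(x - γ) / a⌋ + 1) * a := by
    by_contra! h
    have := hx (⌊(x - γ) / a⌋ + 1) (by push_cast; exact h)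
    push_cast at this
    linarith
  generalize ⌊(x - γ) / a⌋ = k at *
  generalize ⌊(y - γ) / a⌋ = l at *
  have h1' : ((⌊x / a⌋ : ℤ) : ℝ) ≤ ⌊y / a⌋ := by exact_mod_cast h1
  push_cast
  have key : δ * ((l : ℝ) - k) < y - x := by
    rcases h2.eq_or_lt with h | h
    · subst h; simp; linarith
    · have : (k : ℝ) + 1 ≤ l := by exact_mod_cast h
      nlinarith
  nlinarith

/-! ### Gaps: opened at 0, transported by the map, closed at γ -/

namespace CircleSystem

variable {a δ γ σ : ℝ} {S : Set ℝ} (h : CircleSystem a δ γ σ S)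
include h

lemma δ_lt_a : δ < a := h.δ_lt.trans h.lt_a

lemma γ_pos : 0 < γ := h.δ_pos.trans h.δ_lt

lemma step_lt {x y : ℝ} (hx : x ∈ S) (hxy : x < y) : step a δ γ σ x < step a δ γ σ y :=
  step_lt_step h.a_pos h.δ_pos h.δ_lt_a (h.avoid x hx) hxy

lemma step_lt_iff {x y : ℝ} (hx : x ∈ S) (hy : y ∈ S) :
    step a δ γ σ x < step a δ γ σ y ↔ x < y := by
  refine ⟨fun hlt => ?_, h.step_lt hx⟩
  by_contra! hle
  rcases hle.eq_or_lt with he | hl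
  · rw [he] at hlt; exact lt_irrefl _ hlt
  · exact lt_asymm hlt (h.step_lt hy hl)

lemma step_le_iff {x y : ℝ} (hx : x ∈ S) (hy : y ∈ S) :
    step a δ γ σ x ≤ step a δ γ σ y ↔ x ≤ y := by
  rw [← not_lt, ← not_lt, h.step_lt_iff hy hx]

lemma iterate_mem {x : ℝ} (hx : x ∈ S) (k : ℕ) : (step a δ γ σ)^[k] x ∈ S := by
  induction k with
  | zero => exact hx
  | succ k ih => rw [Function.iterate_succ_apply']; exact h.step_mem _ ih

lemma gap_add_mul_iff {ℓ q : ℝ} (j : ℤ) : Gap S ℓ (q + j * a) ↔ Gap S ℓ q := by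
  constructor
  · intro hg s hs hlt
    have := hg (s + j * a) (h.periodic s hs j) (by linarith)
    linarith
  · intro hg s hs hlt
    have := hg (s + (-j : ℤ) * a) (h.periodic s hs (-j)) (by push_cast; linarith)
    push_cast at this
    linarith

lemma exists_mem_ge (p : ℝ) : ∃ s ∈ S, p ≤ s := by
  obtain ⟨x, hx⟩ := h.nonempty
  refine ⟨x + (⌈(p - x) / a⌉ : ℤ) * a, h.periodic x hx _, ?_⟩
  have := (div_le_iff₀ h.a_pos).1 (Int.le_ceil ((p - x) / a))
  linarith

lemma exists_first (p : ℝ) : ∃ q ∈ S, p ≤ q ∧ ∀ s ∈ S, p ≤ s → q ≤ s := by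
  have hb : BddBelow (S ∩ Set.Ici p) := ⟨p, fun x hx => hx.2⟩
  have hne : (S ∩ Set.Ici p).Nonempty := by
    obtain ⟨s, hs, hps⟩ := h.exists_mem_ge p
    exact ⟨s, hs, hps⟩
  refine ⟨sInf (S ∩ Set.Ici p), h.right_closed _ fun ε hε => ?_, le_csInf hne fun x hx => hx.2,
    fun s hs hps => csInf_le hb ⟨hs, hps⟩⟩
  obtain ⟨s, hs, hlt⟩ := exists_lt_of_csInf_lt hne (lt_add_of_pos_right (sInf (S ∩ Set.Ici p)) hε)
  exact ⟨s, hs.1, csInf_le hb hs, hlt⟩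

/-- Between ⌊q/a⌋a and q the only possible jump is downward, so distances to q do not grow under
`step` and a gap of the image was already there. The point s₀ ensures that the left neighbours of q
lie in this range. -/
lemma gap_of_gap_step {ℓ q s₀ : ℝ} (hg : Gap S ℓ (step a δ γ σ q)) (hs₀ : s₀ ∈ S)
    (h₀ : ⌊q / a⌋ * a ≤ s₀) (h₁ : s₀ < q) : Gap S ℓ q := by
  have key : ∀ s ∈ S, s < q → ⌊q / a⌋ * a ≤ s → s < q - ℓ := by
    intro s hs hlt hle
    have e1 : ⌊s / a⌋ = ⌊q / a⌋ :=
      (floor_div_eq h.a_pos _).2 ⟨hle, hlt.trans (lt_floor_div_add_one_mul h.a_pos q)⟩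
    have e2 : ⌊(s - γ) / a⌋ ≤ ⌊(q - γ) / a⌋ :=
      Int.floor_le_floor (by have := h.a_pos; gcongr)
    have e3 : ((⌊(s - γ) / a⌋ : ℤ) : ℝ) ≤ ⌊(q - γ) / a⌋ := by exact_mod_cast e2
    have := hg _ (h.step_mem s hs) (h.step_lt hs hlt)
    unfold step at this
    rw [e1] at this
    push_cast at this
    nlinarith [h.δ_pos]
  intro s hs hlt
  rcases le_total s₀ s with hh | hh
  · exact key s hs hlt (h₀.trans hh)
  · exact hh.trans_lt (key s₀ hs₀ h₁ h₀)

/-- Dual to `gap_of_gap_step`: from the last translate of γ up to q there is no downward jump, so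
distances to q do not shrink. Surjectivity reduces points near the image to their preimages. -/
lemma gap_step_of_gap {ℓ q s₀ : ℝ} (hq : q ∈ S) (hg : Gap S ℓ q) (hs₀ : s₀ ∈ S)
    (h₀ : γ + ⌊(q - γ) / a⌋ * a ≤ s₀) (h₁ : s₀ < q) : Gap S ℓ (step a δ γ σ q) := by
  have key : ∀ s ∈ S, s < q → γ + ⌊(q - γ) / a⌋ * a ≤ s →
      step a δ γ σ s < step a δ γ σ q - ℓ := by
    intro s hs hlt hle
    have e1 : ⌊(s - γ) / a⌋ = ⌊(q - γ) / a⌋ := (floor_div_eq h.a_pos _).2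
      ⟨by linarith, by have := lt_floor_div_add_one_mul h.a_pos (q - γ); linarith⟩
    have e2 : ⌊s / a⌋ ≤ ⌊q / a⌋ := Int.floor_le_floor (by have := h.a_pos; gcongr)
    have e3 : ((⌊s / a⌋ : ℤ) : ℝ) ≤ ⌊q / a⌋ := by exact_mod_cast e2
    have := hg s hs hlt
    unfold step
    rw [e1]
    push_cast
    nlinarith [h.δ_pos]
  intro t ht hlt
  obtain ⟨s, hs, rfl⟩ := h.exists_pre t ht
  rw [h.step_lt_iff hs hq] at hlt
  rcases le_total s₀ s with hh | hh
  · exact key s hs hlt (h₀.trans hh)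
  · exact ((h.step_le_iff hs hs₀).2 hh).trans_lt (key s₀ hs₀ h₁ h₀)

omit h in
-- Gaps at distinct points are disjoint. The induction removes the largest point q and continues to
-- the left of q - ℓ.
lemma card_mul_lt_of_gap {ℓ x : ℝ} (hx : x ∈ S) (F : Finset ℝ) : ∀ x' : ℝ, x < x' →
    (∀ q ∈ F, q ∈ S ∧ x < q ∧ q ≤ x' ∧ Gap S ℓ q) → (F.card : ℝ) * ℓ < x' - x := by
  induction F using Finset.induction_on_max with
  | empty => intro x' hx' _; simpa using hx'
  | insert q F hmax ih =>
    intro x' hx' hF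
    obtain ⟨hqS, hxq, hqx', hg⟩ := hF q (Finset.mem_insert_self _ _)
    have := ih (q - ℓ) (hg x hx hxq) fun r hr => by
      obtain ⟨h1, h2, -, h4⟩ := hF r (Finset.mem_insert_of_mem hr)
      exact ⟨h1, h2, (hg r h1 (hmax r hr)).le, h4⟩
    rw [Finset.card_insert_of_notMem fun hq => lt_irrefl _ (hmax q hq)]
    push_cast
    linarith

lemma not_forall_gap {ℓ : ℝ} (hℓ : 0 < ℓ) (w : ℕ → ℝ) (hw : ∀ k, w k ∈ S)
    (hinj : ∀ i j : ℕ, i < j → ∀ l : ℤ, w i ≠ w j + l * a) : ∃ k, ¬ Gap S ℓ (w k) := by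
  by_contra! hg
  obtain ⟨x, hx⟩ := h.nonempty
  -- The translate of `w k` in (x, x + a].
  let r : ℕ → ℝ := fun k => w k + ((1 - ⌈(w k - x) / a⌉ : ℤ) : ℝ) * a
  have hr : Function.Injective r := by
    have aux : ∀ i j : ℕ, i < j → r i ≠ r j := by
      intro i j hij he
      refine hinj i j hij (⌈(w i - x) / a⌉ - ⌈(w j - x) / a⌉) ?_
      simp only [r] at he
      push_cast at he ⊢
      linarith
    intro i j he
    rcases lt_trichotomy i j with hl | hl | hl
    · exact (aux i j hl he).elim
    · exact hl
    · exact (aux j i hl he.symm).elim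
  obtain ⟨N, hN⟩ := exists_nat_gt (a / ℓ)
  have hcard := card_mul_lt_of_gap (ℓ := ℓ) hx ((Finset.range N).image r) (x + a)
    (by linarith [h.a_pos]) (by
      intro q hq
      obtain ⟨k, -, rfl⟩ := Finset.mem_image.1 hq
      refine ⟨h.periodic _ (hw k) _, ?_, ?_, (h.gap_add_mul_iff _).2 (hg k)⟩
      · have := (lt_div_iff₀ h.a_pos).1 (sub_lt_iff_lt_add.2 (Int.ceil_lt_add_one ((w k - x) / a)))
        simp only [r]; push_cast; linarith
      · have := (div_le_iff₀ h.a_pos).1 (Int.le_ceil ((w k - x) / a))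
        simp only [r]; push_cast; linarith)
  rw [Finset.card_image_of_injective _ hr, Finset.card_range] at hcard
  have := (div_lt_iff₀ hℓ).1 hN
  linarith

/-- Backward orbits exist. -/
lemma exists_backward {q : ℝ} (hq : q ∈ S) : ∃ w : ℕ → ℝ, w 0 = q ∧ (∀ k, w k ∈ S) ∧
    ∀ k, step a δ γ σ (w (k + 1)) = w k := by
  choose! p hp hps using h.exists_pre
  have hm : ∀ k : ℕ, p^[k] q ∈ S := by
    intro k
    induction k with
    | zero => exact hq
    | succ k ih => rw [Function.iterate_succ_apply']; exact hp _ ih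
  exact ⟨fun k => p^[k] q, rfl, hm, fun k => by
    simp only [Function.iterate_succ_apply']; exact hps _ (hm k)⟩

omit h in
lemma iterate_backward {w : ℕ → ℝ} (hw : ∀ k, step a δ γ σ (w (k + 1)) = w k) (i k : ℕ) :
    (step a δ γ σ)^[k] (w (i + k)) = w i := by
  induction k with
  | zero => rfl
  | succ k ih => rw [Function.iterate_succ_apply, ← add_assoc, hw, ih]

/-- A gap pulls back until the preimage is the first point of S in its cell [ja, (j + 1)a). This
must happen, since otherwise infinitely many points distinct modulo a would carry gaps of length ℓ.
-/
lemma exists_backward_first {ℓ q : ℝ} (hℓ : 0 < ℓ) {w : ℕ → ℝ} (hw0 : w 0 = q)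
    (hwS : ∀ k, w k ∈ S) (hw : ∀ k, step a δ γ σ (w (k + 1)) = w k) (hg : Gap S ℓ q) :
    ∃ k, (∀ s ∈ S, s < w (k + 1) → s < ⌊w (k + 1) / a⌋ * a) ∧ Gap S ℓ (w k) := by
  by_contra! hcon
  have hall : ∀ k, Gap S ℓ (w k) := by
    intro k
    induction k with
    | zero => rw [hw0]; exact hg
    | succ k ih =>
      by_contra hng
      refine hcon k (fun s hs hlt => ?_) ih
      by_contra! hle
      exact hng (h.gap_of_gap_step (by rw [hw]; exact ih) hs hle hlt)
  obtain ⟨k, hk⟩ := h.not_forall_gap hℓ w hwS fun i j hij l he => by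
    obtain ⟨n, rfl⟩ := Nat.exists_eq_add_of_lt hij
    refine h.aperiodic (w (i + n + 1)) (n + 1) l (Nat.succ_pos _) ?_
    rw [add_assoc, iterate_backward hw, ← add_assoc]; exact he
  exact hk (hall k)

lemma exists_forward_first {ℓ q : ℝ} (hℓ : 0 < ℓ) (hq : q ∈ S) (hg : Gap S ℓ q) :
    ∃ k, (∀ s ∈ S, s < (step a δ γ σ)^[k] q →
        s < γ + ⌊((step a δ γ σ)^[k] q - γ) / a⌋ * a) ∧
      ∀ i ≤ k, Gap S ℓ ((step a δ γ σ)^[i] q) := by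
  by_contra! hcon
  have hall : ∀ k, ∀ i ≤ k, Gap S ℓ ((step a δ γ σ)^[i] q) := by
    intro k
    induction k with
    | zero => intro i hi; rw [Nat.le_zero.1 hi]; exact hg
    | succ k ih =>
      intro i hi
      rcases Nat.le_succ_iff.1 hi with hi | rfl
      · exact ih i hi
      by_contra hng
      obtain ⟨j, hj, hj'⟩ := hcon k fun s hs hlt => by
        by_contra! hle
        rw [Function.iterate_succ_apply'] at hng
        exact hng (h.gap_step_of_gap (h.iterate_mem hq k) (ih k le_rfl) hs hle hlt)
      exact hj' (ih j hj)
  obtain ⟨k, hk⟩ := h.not_forall_gap hℓ (fun k => (step a δ γ σ)^[k] q) (h.iterate_mem hq)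
    fun i j hij l he => by
      obtain ⟨n, rfl⟩ := Nat.exists_eq_add_of_lt hij
      refine h.aperiodic ((step a δ γ σ)^[i] q) (n + 1) (-l) (Nat.succ_pos _) ?_
      rw [← Function.iterate_add_apply, show n + 1 + i = i + n + 1 by ring]
      rw [he]; push_cast; ring
  exact hk (hall k k le_rfl)

/-- Let q be the first point of S in [0, ∞). A gap at q, followed backward, reaches the first point
of some cell, which is q modulo a, so q would be periodic. Hence q has no gap; this forces q = 0 and
makes S accumulate at 0 from the left. -/
lemma zero_mem_and_forall_exists : (0 : ℝ) ∈ S ∧ ∀ ℓ > 0, ∃ s ∈ S, -ℓ ≤ s ∧ s < 0 := by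
  obtain ⟨q, hq, hq0, hmin⟩ := h.exists_first 0
  have hqa : q < a := by
    by_contra! hle
    have := hmin (q + ((-1 : ℤ) : ℝ) * a) (h.periodic q hq _) (by push_cast; linarith)
    push_cast at this
    linarith [h.a_pos]
  have key : ∀ ℓ > 0, ¬ Gap S ℓ q := by
    intro ℓ hℓ hg
    obtain ⟨w, hw0, hwS, hw⟩ := h.exists_backward hq
    obtain ⟨k, hk, -⟩ := h.exists_backward_first hℓ hw0 hwS hw hg
    refine h.aperiodic (w (k + 1)) (k + 1) (-⌊w (k + 1) / a⌋) (Nat.succ_pos _) ?_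
    have hit := iterate_backward hw 0 (k + 1)
    rw [zero_add] at hit
    rw [hit, hw0]
    set j := ⌊w (k + 1) / a⌋ with hj
    have h1 := floor_div_mul_le h.a_pos (w (k + 1))
    rw [← hj] at h1
    have h2 := hmin (w (k + 1) + ((-j : ℤ) : ℝ) * a) (h.periodic _ (hwS _) _)
      (by push_cast; linarith)
    have h3 : ¬ q + j * a < w (k + 1) := fun hlt => by
      have := hk _ (h.periodic q hq j) hlt
      linarith
    push_cast at h2 h3 ⊢
    linarith
  have hq00 : q = 0 := by
    by_contra hne
    refine key q (lt_of_le_of_ne hq0 (Ne.symm hne)) fun s hs hlt => ?_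
    by_contra! hle
    linarith [hmin s hs (by linarith)]
  subst hq00
  refine ⟨hq, fun ℓ hℓ => ?_⟩
  have := key ℓ hℓ
  unfold Gap at this
  push Not at this
  obtain ⟨s, hs, h1, h2⟩ := this
  exact ⟨s, hs, by linarith, h1⟩

lemma zero_mem : (0 : ℝ) ∈ S := h.zero_mem_and_forall_exists.1

omit h in
lemma step_of_mem_Ico {x : ℝ} (ha : 0 < a) (hγ : γ < a) (h0 : 0 ≤ x) (h1 : x < γ) :
    step a δ γ σ x = x + σ + δ := by
  have e1 : ⌊x / a⌋ = 0 := (floor_div_eq ha 0).2 ⟨by simpa, by push_cast; linarith⟩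
  have e2 : ⌊(x - γ) / a⌋ = -1 :=
    (floor_div_eq ha (-1)).2 ⟨by push_cast; linarith, by push_cast; linarith⟩
  simp [step, e1, e2]

omit h in
lemma step_of_mem_Ico' {x : ℝ} (ha : 0 < a) (hγ : 0 < γ) (h0 : γ ≤ x) (h1 : x < a) :
    step a δ γ σ x = x + σ := by
  have e1 : ⌊x / a⌋ = 0 := (floor_div_eq ha 0).2 ⟨by push_cast; linarith, by push_cast; linarith⟩
  have e2 : ⌊(x - γ) / a⌋ = 0 :=
    (floor_div_eq ha 0).2 ⟨by push_cast; linarith, by push_cast; linarith⟩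
  simp [step, e1, e2]

lemma step_zero : step a δ γ σ 0 = σ + δ := by
  rw [step_of_mem_Ico h.a_pos h.lt_a le_rfl h.γ_pos, zero_add]

lemma step_of_neg {s : ℝ} (h0 : γ - a ≤ s) (h1 : s < 0) : step a δ γ σ s = s + σ := by
  have := step_add_mul h.a_pos δ γ σ s 1
  rw [step_of_mem_Ico' h.a_pos h.γ_pos (by push_cast; linarith) (by push_cast; linarith)] at this
  linarith

/-- Birth of a gap: 0 moves by σ + δ, whereas its close left neighbours move by σ only. -/
lemma gap_step_zero : Gap S δ (step a δ γ σ 0) := by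
  intro t ht hlt
  obtain ⟨s, hs, rfl⟩ := h.exists_pre t ht
  rw [h.step_lt_iff hs h.zero_mem] at hlt
  obtain ⟨s₂, hs₂, h1, h2⟩ := h.zero_mem_and_forall_exists.2 (a - γ) (by linarith [h.lt_a])
  rw [h.step_zero]
  rcases le_total s₂ s with hh | hh
  · rw [h.step_of_neg (by linarith) hlt]; linarith
  · have := (h.step_le_iff hs hs₂).2 hh
    rw [h.step_of_neg (by linarith) h2] at this
    linarith

lemma le_of_gap_step_zero {ℓ : ℝ} (hg : Gap S ℓ (step a δ γ σ 0)) : ℓ ≤ δ := by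
  by_contra! hlt
  obtain ⟨s, hs, h1, h2⟩ := h.zero_mem_and_forall_exists.2 (min (ℓ - δ) (a - γ))
    (lt_min (by linarith) (by linarith [h.lt_a]))
  have h3 := min_le_left (ℓ - δ) (a - γ)
  have h4 := min_le_right (ℓ - δ) (a - γ)
  have := hg _ (h.step_mem s hs) (h.step_lt hs h2)
  rw [h.step_zero, h.step_of_neg (by linarith) h2] at this
  linarith

lemma eq_of_first_zero {z : ℝ} (hz : ∀ s ∈ S, s < z → s < ⌊z / a⌋ * a) : z = ⌊z / a⌋ * a := by
  refine le_antisymm ?_ (floor_div_mul_le h.a_pos z)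
  by_contra! hlt
  have := hz (0 + ⌊z / a⌋ * a) (h.periodic 0 h.zero_mem _) (by linarith)
  linarith

lemma exists_eq_iterate_of_gap {ℓ q : ℝ} (hℓ : 0 < ℓ) (hq : q ∈ S) (hg : Gap S ℓ q) :
    ℓ ≤ δ ∧ ∃ (k : ℕ) (j : ℤ), 1 ≤ k ∧ q = (step a δ γ σ)^[k] 0 + j * a := by
  obtain ⟨w, hw0, hwS, hw⟩ := h.exists_backward hq
  obtain ⟨k, hk, hgk⟩ := h.exists_backward_first hℓ hw0 hwS hw hg
  have he := h.eq_of_first_zero hk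
  set j := ⌊w (k + 1) / a⌋
  constructor
  · rw [← hw, he, ← zero_add ((j : ℝ) * a), step_add_mul h.a_pos, h.gap_add_mul_iff] at hgk
    exact h.le_of_gap_step_zero hgk
  · refine ⟨k + 1, j, by omega, ?_⟩
    have hit := iterate_backward hw 0 (k + 1)
    rw [zero_add, hw0, he] at hit
    rw [← hit, ← iterate_step_add_mul h.a_pos, zero_add]

/-- Otherwise let q > γ be the first point of S beyond γ. Nothing of S lies in [γ - δ, q), so the
image of q still has a gap of length q - γ. Its forward orbit must reach the first point beyond a
translate of γ, which is q modulo a, and q would be periodic. -/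
lemma γ_mem : γ ∈ S := by
  obtain ⟨q, hq, hq0, hmin⟩ := h.exists_first γ
  rcases hq0.eq_or_lt with he | hlt
  · rwa [he]
  exfalso
  have hqa : q ≤ a := hmin a (by have := h.periodic 0 h.zero_mem 1; simpa using this) h.lt_a.le
  -- Only an inequality, because q = a is not yet excluded and there the displacement is σ + δ.
  have hsq : q + σ ≤ step a δ γ σ q := by
    rcases hqa.eq_or_lt with he | hl
    · have := step_add_mul h.a_pos δ γ σ 0 1
      rw [h.step_zero] at this
      simp only [Int.cast_one, one_mul, zero_add] at this
      rw [he, this]; linarith [h.δ_pos]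
    · rw [step_of_mem_Ico' h.a_pos h.γ_pos hq0 hl]
  have hg : Gap S (q - γ) (step a δ γ σ q) := by
    have key : ∀ s ∈ S, 0 ≤ s → s < q → step a δ γ σ s < step a δ γ σ q - (q - γ) := by
      intro s hs h0 hl
      have h1 : s < γ := by
        by_contra! hle
        linarith [hmin s hs hle]
      have h2 : s < γ - δ := by
        by_contra! hle
        have := h.avoid s hs 0 (by simpa using hle)
        simp at this
        linarith
      rw [step_of_mem_Ico h.a_pos h.lt_a h0 h1]
      linarith
    intro t ht hl
    obtain ⟨s, hs, rfl⟩ := h.exists_pre t ht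
    rw [h.step_lt_iff hs hq] at hl
    rcases le_total 0 s with hh | hh
    · exact key s hs hh hl
    · exact ((h.step_le_iff hs h.zero_mem).2 hh).trans_lt
        (key 0 h.zero_mem le_rfl (h.γ_pos.trans hlt))
  obtain ⟨k, hk, -⟩ := h.exists_forward_first (sub_pos.2 hlt) (h.step_mem q hq) hg
  rw [← Function.iterate_succ_apply] at hk
  set z := (step a δ γ σ)^[k + 1] q with hz
  have hzS : z ∈ S := h.iterate_mem hq _
  set j := ⌊(z - γ) / a⌋ with hj
  refine h.aperiodic q (k + 1) j (Nat.succ_pos _) ?_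
  rw [← hz]
  have h1 := floor_div_mul_le h.a_pos (z - γ)
  rw [← hj] at h1
  have h2 := hmin (z + ((-j : ℤ) : ℝ) * a) (h.periodic _ hzS _) (by push_cast; linarith)
  have h3 : ¬ q + j * a < z := fun hl => by
    have := hk _ (h.periodic q hq j) hl
    linarith
  push_cast at h2
  linarith

lemma eq_of_first_γ {z : ℝ} (hz : ∀ s ∈ S, s < z → s < γ + ⌊(z - γ) / a⌋ * a) :
    z = γ + ⌊(z - γ) / a⌋ * a := by
  refine le_antisymm ?_ (by linarith [floor_div_mul_le h.a_pos (z - γ)])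
  by_contra! hlt
  have := hz (γ + ⌊(z - γ) / a⌋ * a) (h.periodic γ h.γ_mem _) hlt
  linarith

/-- The orbit of `0` reaches `γ` modulo `a`, with gaps of length `δ` along the way. -/
lemma exists_iterate_eq : ∃ (D : ℕ) (m : ℤ), 1 ≤ D ∧ (step a δ γ σ)^[D] 0 = γ + m * a ∧
    ∀ n, 1 ≤ n → n ≤ D → Gap S δ ((step a δ γ σ)^[n] 0) := by
  obtain ⟨k, hk, hg⟩ := h.exists_forward_first h.δ_pos (h.step_mem 0 h.zero_mem) h.gap_step_zero
  simp only [← Function.iterate_succ_apply] at hk hg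
  refine ⟨k + 1, _, by omega, h.eq_of_first_γ hk, fun n h1 h2 => ?_⟩
  obtain ⟨i, rfl⟩ := Nat.exists_eq_add_of_le' h1
  exact hg i (by omega)

lemma iterate_zero_injective {i j : ℕ} {l : ℤ}
    (he : (step a δ γ σ)^[i] 0 = (step a δ γ σ)^[j] 0 + l * a) : i = j := by
  have aux : ∀ (i j : ℕ) (l : ℤ), i < j →
      (step a δ γ σ)^[i] 0 ≠ (step a δ γ σ)^[j] 0 + l * a := by
    intro i j l hij he
    obtain ⟨n, rfl⟩ := Nat.exists_eq_add_of_lt hij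
    refine h.aperiodic ((step a δ γ σ)^[i] 0) (n + 1) (-l) (Nat.succ_pos _) ?_
    rw [← Function.iterate_add_apply, show n + 1 + i = i + n + 1 by ring, he]; push_cast; ring
  rcases lt_trichotomy i j with hl | hl | hl
  · exact (aux i j l hl he).elim
  · exact hl
  · exact (aux j i (-l) hl (by rw [he]; push_cast; ring)).elim

lemma gap_iterate {D n : ℕ} {m : ℤ} (hD : (step a δ γ σ)^[D] 0 = γ + m * a) (h1 : 1 ≤ n)
    (h2 : n ≤ D) : Gap S δ ((step a δ γ σ)^[n] 0) := by
  obtain ⟨D', m', -, hD', hg⟩ := h.exists_iterate_eq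
  have : D = D' := h.iterate_zero_injective (l := m - m') (by rw [hD, hD']; push_cast; ring)
  exact hg n h1 (this ▸ h2)

/-- With q the next point of S after x, the gap at q comes from 0 after k steps and reaches γ after
i more. The time at which the orbit of 0 meets γ is unique, so i + k = D and k ≤ D. -/
lemma exists_hole_of_notMem {D : ℕ} {m : ℤ} (hD : (step a δ γ σ)^[D] 0 = γ + m * a) {x : ℝ}
    (hx : x ∉ S) : ∃ (n : ℕ) (j : ℤ), 1 ≤ n ∧ n ≤ D ∧
      x ∈ Set.Ico ((step a δ γ σ)^[n] 0 + j * a - δ) ((step a δ γ σ)^[n] 0 + j * a) := by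
  obtain ⟨q, hq, hxq, hmin⟩ := h.exists_first x
  have hlt : x < q := lt_of_le_of_ne hxq fun he => hx (he ▸ hq)
  have hg : Gap S (q - x) q := by
    intro s hs hl
    by_contra! hle
    linarith [hmin s hs (by linarith)]
  obtain ⟨hℓ, k, j, hk, he⟩ := h.exists_eq_iterate_of_gap (sub_pos.2 hlt) hq hg
  obtain ⟨i, hi, -⟩ := h.exists_forward_first (sub_pos.2 hlt) hq hg
  have hi' := h.eq_of_first_γ hi
  generalize ⌊((step a δ γ σ)^[i] q - γ) / a⌋ = l at hi'
  rw [he, iterate_step_add_mul h.a_pos, ← Function.iterate_add_apply] at hi'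
  have : D = i + k := h.iterate_zero_injective (l := m + j - l) (by
    rw [hD]; push_cast; linarith)
  exact ⟨k, j, hk, by omega, by rw [← he]; exact ⟨by linarith, hlt⟩⟩

end CircleSystem

/-- The representative of `x` modulo `a` in `[0, a)`. -/
def red (a x : ℝ) : ℝ := x - ⌊x / a⌋ * a

lemma red_nonneg {a : ℝ} (ha : 0 < a) (x : ℝ) : 0 ≤ red a x := by
  have := floor_div_mul_le ha x
  unfold red; linarith

lemma red_lt {a : ℝ} (ha : 0 < a) (x : ℝ) : red a x < a := by
  have := lt_floor_div_add_one_mul ha x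
  unfold red; linarith

lemma red_eq_iff {a : ℝ} (ha : 0 < a) {x y : ℝ} (h0 : 0 ≤ y) (h1 : y < a) :
    red a x = y ↔ ∃ j : ℤ, x = y + j * a := by
  constructor
  · rintro rfl; exact ⟨⌊x / a⌋, by unfold red; ring⟩
  · rintro ⟨j, rfl⟩
    have : ⌊(y + j * a) / a⌋ = j := (floor_div_eq ha j).2 ⟨by linarith, by linarith⟩
    simp [red, this]

lemma eq_red_add {a : ℝ} (x : ℝ) : x = red a x + ⌊x / a⌋ * a := by unfold red; ring

/-- The difference of floors counts the points of q + aℤ in (0, γ]; there is at most one because γ <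
a. -/
lemma floor_sub_div_eq_of_red {a γ q : ℝ} (ha : 0 < a) (h0 : 0 ≤ γ) (h1 : γ < a)
    (hq : 0 < red a q) :
    ⌊(γ - q) / a⌋ - ⌊(0 - q) / a⌋ = if red a q ≤ γ then 1 else 0 := by
  have hlt := red_lt ha q
  have e0 : ⌊(0 - q) / a⌋ = -⌊q / a⌋ - 1 := by
    refine (floor_div_eq ha _).2 ⟨?_, ?_⟩ <;> unfold red at * <;> push_cast <;> linarith
  rw [e0]
  split_ifs with hle
  · have e1 : ⌊(γ - q) / a⌋ = -⌊q / a⌋ := by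
      refine (floor_div_eq ha _).2 ⟨?_, ?_⟩ <;> unfold red at * <;> push_cast <;> linarith
    rw [e1]; ring
  · have e1 : ⌊(γ - q) / a⌋ = -⌊q / a⌋ - 1 := by
      refine (floor_div_eq ha _).2 ⟨?_, ?_⟩ <;> unfold red at * <;> push_cast <;> linarith
    rw [e1]; ring

lemma step_eq_of_red {a δ γ σ : ℝ} (ha : 0 < a) (h0 : 0 ≤ γ) (h1 : γ < a) (x : ℝ) :
    step a δ γ σ x = x + σ + δ * (if red a x < γ then 1 else 0) := by
  have hx := eq_red_add (a := a) x
  have hs := step_add_mul ha δ γ σ (red a x) ⌊x / a⌋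
  rw [← hx] at hs
  rw [hs]
  split_ifs with hlt
  · rw [CircleSystem.step_of_mem_Ico ha h1 (red_nonneg ha x) hlt]; linarith
  · have e1 : ⌊red a x / a⌋ = 0 :=
      (floor_div_eq ha 0).2 ⟨by simpa using red_nonneg ha x, by simpa using red_lt ha x⟩
    have e2 : ⌊(red a x - γ) / a⌋ = 0 := (floor_div_eq ha 0).2
      ⟨by push_cast; linarith, by have := red_lt ha x; push_cast; linarith⟩
    simp only [step, e1, e2]
    push_cast
    linarith

/-! ### Counting orbit points modulo a -/

/-- Trades the times 1, …, D for 0, …, D - 1, that is, the end point γ of the orbit segment for its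
start 0. -/
lemma sum_range_add_eq {M : Type*} [AddCommMonoid M] (g : ℕ → M) (D : ℕ) :
    ∑ n ∈ Finset.range D, g n + g D = ∑ n ∈ Finset.range D, g (n + 1) + g 0 := by
  rw [← Finset.sum_range_succ, Finset.sum_range_succ']

lemma iterate_step_zero {a δ γ σ : ℝ} (ha : 0 < a) (h0 : 0 ≤ γ) (h1 : γ < a) (k : ℕ) :
    (step a δ γ σ)^[k] 0 = k * σ + δ * ∑ n ∈ Finset.range k,
      (if red a ((step a δ γ σ)^[n] 0) < γ then (1 : ℝ) else 0) := by
  induction k with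
  | zero => simp
  | succ k ih =>
    rw [Function.iterate_succ_apply', step_eq_of_red ha h0 h1, Finset.sum_range_succ]
    generalize (if red a ((step a δ γ σ)^[k] 0) < γ then (1 : ℝ) else 0) = i
    rw [ih]
    push_cast; ring

/-- The sum of the counting functions of the classes of `Q 1, …, Q D` modulo `a`. -/
def hits (a : ℝ) (Q : ℕ → ℝ) (D : ℕ) (x : ℝ) : ℤ :=
  ∑ n ∈ Finset.range D, ⌊(x - Q (n + 1)) / a⌋

lemma hits_add_mul {a : ℝ} (ha : 0 < a) (Q : ℕ → ℝ) (D : ℕ) (x : ℝ) (j : ℤ) :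
    hits a Q D (x + j * a) = hits a Q D x + D * j := by
  unfold hits
  have : ∀ n, ⌊(x + j * a - Q (n + 1)) / a⌋ = ⌊(x - Q (n + 1)) / a⌋ + j := fun n => by
    rw [show x + j * a - Q (n + 1) = x - Q (n + 1) + j * a by ring, floor_add_mul_div ha]
  simp [this, Finset.sum_add_distrib]

lemma hits_mono {a : ℝ} (ha : 0 < a) (Q : ℕ → ℝ) (D : ℕ) {x y : ℝ} (hxy : x ≤ y) :
    hits a Q D x ≤ hits a Q D y :=
  Finset.sum_le_sum fun n _ => Int.floor_le_floor (by gcongr)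

lemma hits_sub_zero {a γ : ℝ} {Q : ℕ → ℝ} {D : ℕ} (ha : 0 < a) (h0 : 0 ≤ γ) (h1 : γ < a)
    (hQ : ∀ n < D, 0 < red a (Q (n + 1))) :
    hits a Q D γ - hits a Q D 0 =
      ∑ n ∈ Finset.range D, if red a (Q (n + 1)) ≤ γ then (1 : ℤ) else 0 := by
  unfold hits
  rw [← Finset.sum_sub_distrib]
  exact Finset.sum_congr rfl fun n hn =>
    floor_sub_div_eq_of_red ha h0 h1 (hQ n (Finset.mem_range.1 hn))

/-- The additional 1 is the last point, which alone lies at γ; this is the source of d₁ + 1 in the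
conditions. -/
lemma sum_ite_red_le {a γ : ℝ} {Q : ℕ → ℝ} {D : ℕ} (hD : 1 ≤ D)
    (hQ : ∀ n < D, red a (Q (n + 1)) = γ ↔ n + 1 = D) :
    (∑ n ∈ Finset.range D, if red a (Q (n + 1)) ≤ γ then (1 : ℤ) else 0) =
      ((Finset.range D).filter fun n => red a (Q (n + 1)) < γ).card + 1 := by
  have : ∀ n ∈ Finset.range D, (if red a (Q (n + 1)) ≤ γ then (1 : ℤ) else 0) =
      (if red a (Q (n + 1)) < γ then 1 else 0) + if n = D - 1 then 1 else 0 := by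
    intro n hn
    have h1 := hQ n (Finset.mem_range.1 hn)
    by_cases h2 : n = D - 1
    · have h3 := h1.2 (by omega)
      rw [if_pos h3.le, if_neg h3.not_lt, if_pos h2, zero_add]
    · have h3 : red a (Q (n + 1)) ≠ γ := fun h => h2 (by have := h1.1 h; omega)
      simp [h2, le_iff_lt_or_eq, h3]
  rw [Finset.sum_congr rfl this, Finset.sum_add_distrib, Finset.sum_boole,
    Finset.sum_ite_eq' (Finset.range D) (D - 1), if_pos (Finset.mem_range.2 (by omega))]

lemma card_filter_add_card_filter {a γ : ℝ} {Q : ℕ → ℝ} {D : ℕ} (hD : 1 ≤ D)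
    (hQ : ∀ n < D, red a (Q (n + 1)) = γ ↔ n + 1 = D) :
    ((Finset.range D).filter fun n => red a (Q (n + 1)) < γ).card +
      ((Finset.range D).filter fun n => γ < red a (Q (n + 1))).card + 1 = D := by
  have h1 := sum_ite_red_le hD hQ
  rw [Finset.sum_boole] at h1
  have h2 := Finset.card_filter_add_card_filter_not (s := Finset.range D)
    (fun n => red a (Q (n + 1)) ≤ γ)
  simp only [not_le, Finset.card_range] at h2
  norm_cast at h1
  omega

/-! ### The holes as components, and the rotation obtained by collapsing them -/

namespace CircleSystem

variable {a δ γ σ : ℝ} {S : Set ℝ} (h : CircleSystem a δ γ σ S) {D : ℕ} {m : ℤ}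
  (hD : (step a δ γ σ)^[D] 0 = γ + m * a)
include h

lemma red_mem {x : ℝ} (hx : x ∈ S) : red a x ∈ S := by
  have := h.periodic x hx (-⌊x / a⌋)
  push_cast at this
  unfold red
  rwa [neg_mul, ← sub_eq_add_neg] at this

lemma gap_red_iff {ℓ q : ℝ} : Gap S ℓ (red a q) ↔ Gap S ℓ q := by
  conv_rhs => rw [eq_red_add (a := a) q]
  exact (h.gap_add_mul_iff _).symm

lemma red_iterate_mem (n : ℕ) : red a ((step a δ γ σ)^[n] 0) ∈ S :=
  h.red_mem (h.iterate_mem h.zero_mem n)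

lemma red_iterate_pos (n : ℕ) : 0 < red a ((step a δ γ σ)^[n + 1] 0) := by
  refine (red_nonneg h.a_pos _).lt_of_ne' fun he => ?_
  obtain ⟨j, hj⟩ := (red_eq_iff h.a_pos le_rfl h.a_pos).1 he
  exact h.aperiodic 0 (n + 1) j (Nat.succ_pos _) hj

include hD in
lemma red_iterate_eq_iff (n : ℕ) : red a ((step a δ γ σ)^[n] 0) = γ ↔ n = D := by
  rw [red_eq_iff h.a_pos h.γ_pos.le h.lt_a]
  constructor
  · rintro ⟨j, hj⟩
    exact h.iterate_zero_injective (l := j - m) (by rw [hj, hD]; push_cast; ring)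
  · rintro rfl; exact ⟨m, hD⟩

include hD in
lemma one_le : 1 ≤ D := by
  rw [Nat.one_le_iff_ne_zero, ← pos_iff_ne_zero]
  by_contra! h0
  obtain rfl := Nat.le_zero.1 h0
  have := (h.red_iterate_eq_iff hD 0).2 rfl
  have hr : red a (0 : ℝ) = 0 := (red_eq_iff h.a_pos le_rfl h.a_pos).2 ⟨0, by simp⟩
  simp only [Function.iterate_zero, id, hr] at this
  linarith [h.γ_pos]

lemma red_iterate_injective :
    Function.Injective fun n => red a ((step a δ γ σ)^[n + 1] 0) := by
  intro i j he
  simp only at he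
  have h1 := eq_red_add (a := a) ((step a δ γ σ)^[i + 1] 0)
  have h2 := eq_red_add (a := a) ((step a δ γ σ)^[j + 1] 0)
  have := h.iterate_zero_injective (i := i + 1) (j := j + 1)
    (l := ⌊(step a δ γ σ)^[i + 1] 0 / a⌋ - ⌊(step a δ γ σ)^[j + 1] 0 / a⌋)
    (by push_cast; linarith)
  omega

/-- The component stops on the right at q ∈ S. Extending it to the left would produce a gap longer
than δ at q, which `exists_eq_iterate_of_gap` excludes. -/
lemma connectedComponentIn_eq {q x : ℝ} (hq : q ∈ S) (hg : Gap S δ q)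
    (hx : x ∈ Set.Ico (q - δ) q) :
    connectedComponentIn Sᶜ x = Set.Ico (q - δ) q := by
  have hsub : Set.Ico (q - δ) q ⊆ Sᶜ := fun y hy hyS => by
    have := hg y hyS hy.2
    linarith [hy.1]
  apply Set.Subset.antisymm
  · intro y hy
    have hconn := (isPreconnected_connectedComponentIn (F := Sᶜ) (x := x)).ordConnected
    have hxC := mem_connectedComponentIn (hsub hx)
    have hCS := connectedComponentIn_subset Sᶜ x
    constructor
    · by_contra! hlt
      have hng : ¬ Gap S (q - y) q := fun hg' => by
        have := (h.exists_eq_iterate_of_gap (by linarith [h.δ_pos]) hq hg').1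
        linarith
      unfold Gap at hng
      push Not at hng
      obtain ⟨s, hs, h1, h2⟩ := hng
      have := hg s hs h1
      exact hCS (hconn.out hy hxC ⟨by linarith, by linarith [hx.1]⟩) hs
    · by_contra! hle
      exact hCS (hconn.out hxC hy ⟨hx.2.le, hle⟩) hq
  · exact isPreconnected_Ico.subset_connectedComponentIn hx hsub

include hD in
-- Holes are counted by their right ends. Since p ∈ S, a hole ending beyond p cannot begin before p.
lemma encard_holes {p p' : ℝ} (hp : p ∈ S) (hp0 : 0 ≤ p) (hpa : p' ≤ a) :
    {H | (∃ x ∈ Sᶜ, H = connectedComponentIn Sᶜ x) ∧ H ⊆ Set.Ico p p'}.encard =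
      ((Finset.range D).filter fun n => p < red a ((step a δ γ σ)^[n + 1] 0) ∧
        red a ((step a δ γ σ)^[n + 1] 0) ≤ p').card := by
  rw [← Set.encard_coe_eq_coe_finsetCard]
  set F : ℕ → Set ℝ := fun n => Set.Ico (red a ((step a δ γ σ)^[n + 1] 0) - δ)
    (red a ((step a δ γ σ)^[n + 1] 0)) with hF
  have hδ := h.δ_pos
  have hne : ∀ q : ℝ, q - δ ∈ Set.Ico (q - δ) q := fun q => ⟨le_rfl, by linarith⟩
  have hinj : Function.Injective F := by
    intro i j hij
    refine h.red_iterate_injective ?_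
    have := (Set.Ico_eq_Ico_iff (Or.inl (by linarith))).1 hij
    exact this.2
  rw [← hinj.encard_image]
  congr 1
  ext H
  simp only [Set.mem_ofPred_eq, Set.mem_image, Finset.coe_filter, Finset.mem_range]
  constructor
  · rintro ⟨⟨x, hx, rfl⟩, hsub⟩
    obtain ⟨n, j, h1, h2, hxq⟩ := h.exists_hole_of_notMem hD hx
    set q := (step a δ γ σ)^[n] 0 + j * a with hq
    have hqS : q ∈ S := h.periodic _ (h.iterate_mem h.zero_mem n) j
    have hg : Gap S δ q := (h.gap_add_mul_iff j).2 (h.gap_iterate hD h1 h2)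
    rw [h.connectedComponentIn_eq hqS hg hxq] at hsub ⊢
    obtain ⟨h3, h4⟩ := (Set.Ico_subset_Ico_iff (by linarith)).1 hsub
    -- The end a is impossible since the orbit never returns to 0 modulo a, so q is its own
    -- representative in [0, a).
    have hqa : q < a := by
      refine (h4.trans hpa).lt_of_ne fun he => ?_
      have := h.aperiodic 0 n (1 - j) (by omega)
      apply this
      push_cast; linarith
    have hred : red a ((step a δ γ σ)^[n] 0) = q :=
      (red_eq_iff h.a_pos (by linarith) hqa).2 ⟨-j, by rw [hq]; push_cast; ring⟩
    obtain ⟨i, rfl⟩ := Nat.exists_eq_add_of_le' h1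
    exact ⟨i, ⟨by omega, by rw [hred]; exact ⟨by linarith, h4⟩⟩, by rw [hF]; simp only [hred]⟩
  · rintro ⟨n, ⟨hn, h1, h2⟩, rfl⟩
    have hqS := h.red_iterate_mem (n + 1)
    have hg := h.gap_red_iff.2 (h.gap_iterate hD (n := n + 1) (by omega) (by omega))
    refine ⟨⟨_, fun hS => ?_, (h.connectedComponentIn_eq hqS hg (hne _)).symm⟩, ?_⟩
    · have := hg _ hS (by linarith)
      exact lt_irrefl _ this
    · exact Set.Ico_subset_Ico (hg p hp h1).le h2

include hD in
lemma encard_holes_left :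
    {H | (∃ x ∈ Sᶜ, H = connectedComponentIn Sᶜ x) ∧ H ⊆ Set.Ico 0 (γ - δ)}.encard =
      ((Finset.range D).filter fun n => red a ((step a δ γ σ)^[n + 1] 0) < γ).card := by
  rw [h.encard_holes hD h.zero_mem le_rfl (by linarith [h.lt_a, h.δ_pos])]
  congr 2
  refine Finset.filter_congr fun n _ => ⟨fun hh => by linarith [hh.2, h.δ_pos], fun hh =>
    ⟨h.red_iterate_pos n, ?_⟩⟩
  by_contra! hlt
  have := h.avoid _ (h.red_iterate_mem (n + 1)) 0 (by simpa using hlt.le)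
  simp only [Int.cast_zero, zero_mul, add_zero] at this
  linarith

include hD in
lemma encard_holes_right :
    {H | (∃ x ∈ Sᶜ, H = connectedComponentIn Sᶜ x) ∧ H ⊆ Set.Ico γ a}.encard =
      ((Finset.range D).filter fun n => γ < red a ((step a δ γ σ)^[n + 1] 0)).card := by
  rw [h.encard_holes hD h.γ_mem h.γ_pos.le le_rfl]
  congr 2
  exact Finset.filter_congr fun n _ => and_iff_left (red_lt h.a_pos _).le

include hD in
-- Since `step` preserves order on S, applying it to x and to all orbit points leaves the floors
-- unchanged. The shift of index then exchanges Q_0 = 0 for Q_D = γ + ma.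
lemma hits_step {x : ℝ} (hx : x ∈ S) :
    hits a (fun n => (step a δ γ σ)^[n] 0) D (step a δ γ σ x) =
      hits a (fun n => (step a δ γ σ)^[n] 0) D x + ⌊x / a⌋ - ⌊(x - γ) / a⌋ + m := by
  have hfl : ∀ y ∈ S, ⌊(step a δ γ σ x - step a δ γ σ y) / a⌋ = ⌊(x - y) / a⌋ := by
    intro y hy
    rw [floor_div_eq h.a_pos]
    have h1 := floor_div_mul_le h.a_pos (x - y)
    have h2 := lt_floor_div_add_one_mul h.a_pos (x - y)
    set j := ⌊(x - y) / a⌋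
    have h3 := (h.step_le_iff (h.periodic y hy j) hx).2 (by linarith)
    have h4 := (h.step_lt_iff hx (h.periodic y hy (j + 1))).2 (by push_cast; linarith)
    rw [step_add_mul h.a_pos] at h3 h4
    push_cast at h4
    exact ⟨by linarith, by linarith⟩
  have hs : hits a (fun n => (step a δ γ σ)^[n] 0) D (step a δ γ σ x) =
      ∑ n ∈ Finset.range D, ⌊(x - (step a δ γ σ)^[n] 0) / a⌋ :=
    Finset.sum_congr rfl fun n _ => by
      simp only [Function.iterate_succ_apply']
      rw [hfl _ (h.iterate_mem h.zero_mem n)]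
  have hsum := sum_range_add_eq (fun n => ⌊(x - (step a δ γ σ)^[n] 0) / a⌋) D
  have hlast : ⌊(x - (step a δ γ σ)^[D] 0) / a⌋ = ⌊(x - γ) / a⌋ - m := by
    rw [hD, show x - (γ + m * a) = x - γ + (-m : ℤ) * a by push_cast; ring,
      floor_add_mul_div h.a_pos]; ring
  simp only [hlast, Function.iterate_zero, id, sub_zero] at hsum
  rw [hs]
  unfold hits
  linarith

include hD in
-- Each orbit point counted in (x, x'] ends a gap of length δ to the right of x, and these gaps are
-- disjoint. The bound x' ≤ x + a means that each class contributes at most once.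
lemma hits_lt {x x' : ℝ} (hx : x ∈ S) (hlt : x < x') (hle : x' ≤ x + a) :
    δ * ((hits a (fun n => (step a δ γ σ)^[n] 0) D x' : ℝ) -
      hits a (fun n => (step a δ γ σ)^[n] 0) D x) < x' - x := by
  set Q : ℕ → ℝ := fun n => (step a δ γ σ)^[n] 0 with hQ
  set I := (Finset.range D).filter fun n => ⌊(x - Q (n + 1)) / a⌋ < ⌊(x' - Q (n + 1)) / a⌋
  have hcard : hits a Q D x' - hits a Q D x ≤ I.card := by
    unfold hits
    rw [← Finset.sum_sub_distrib, ← Finset.sum_boole]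
    refine Finset.sum_le_sum fun n _ => ?_
    have hm : ⌊(x' - Q (n + 1)) / a⌋ ≤ ⌊(x - Q (n + 1)) / a⌋ + 1 := by
      rw [← Int.cast_one (R := ℤ), ← floor_add_mul_div h.a_pos]
      apply Int.floor_le_floor
      have := h.a_pos
      gcongr
      push_cast; linarith
    split_ifs with hh <;> omega
  let r : ℕ → ℝ := fun n => Q (n + 1) + ⌊(x' - Q (n + 1)) / a⌋ * a
  have hr : Function.Injective r := by
    intro i j hij
    have := h.iterate_zero_injective (i := i + 1) (j := j + 1)
      (l := ⌊(x' - Q (j + 1)) / a⌋ - ⌊(x' - Q (i + 1)) / a⌋)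
      (by simp only [r, hQ] at hij ⊢; push_cast; linarith)
    omega
  have hgap := card_mul_lt_of_gap (S := S) (ℓ := δ) hx (I.image r) x' hlt (by
    intro q hq
    obtain ⟨n, hn, rfl⟩ := Finset.mem_image.1 hq
    obtain ⟨hn1, hn2⟩ := Finset.mem_filter.1 hn
    have hn1 := Finset.mem_range.1 hn1
    refine ⟨h.periodic _ (h.iterate_mem h.zero_mem _) _, ?_, ?_, (h.gap_add_mul_iff _).2
      (h.gap_iterate hD (by omega) (by omega))⟩
    · have h1 := lt_floor_div_add_one_mul h.a_pos (x - Q (n + 1))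
      have h2 : ((⌊(x - Q (n + 1)) / a⌋ : ℤ) : ℝ) + 1 ≤ ⌊(x' - Q (n + 1)) / a⌋ := by
        exact_mod_cast hn2
      have := mul_le_mul_of_nonneg_right h2 h.a_pos.le
      simp only [r]; linarith
    · have := floor_div_mul_le h.a_pos (x' - Q (n + 1))
      simp only [r]; linarith)
  rw [Finset.card_image_of_injective _ hr] at hgap
  have hc : ((hits a Q D x' : ℝ) - hits a Q D x) ≤ I.card := by exact_mod_cast hcard
  nlinarith [h.δ_pos]

/-- The parameters that a circle system gives rise to, with `d₁` and `d₂` the numbers of gaps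
on the two sides of `γ`. -/
theorem parameters {d₁ : ℕ}
    (hd₁ : ((Finset.range D).filter fun n => red a ((step a δ γ σ)^[n + 1] 0) < γ).card = d₁)
    (hD : (step a δ γ σ)^[D] 0 = γ + m * a) :
    D * σ + (d₁ + 1) * δ = γ + m * a ∧ (d₁ + 1) * δ < γ ∧ γ < a - (D - (d₁ + 1)) * δ ∧
      ∀ n < D, ((∃ k : ℤ, ((n + 1 : ℕ) : ℝ) * (σ - m * δ) - k * (a - D * δ) ∈
        Set.Ico 0 (γ - (d₁ + 1) * δ)) ↔ red a ((step a δ γ σ)^[n + 1] 0) < γ) := by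
  have hsum : (D : ℝ) * σ + (d₁ + 1) * δ = γ + m * a := by
    have h1 := sum_range_add_eq
      (fun n => if red a ((step a δ γ σ)^[n] 0) < γ then (1 : ℝ) else 0) D
    rw [← hD, iterate_step_zero h.a_pos h.γ_pos.le h.lt_a]
    have hr : red a (0 : ℝ) = 0 := (red_eq_iff h.a_pos le_rfl h.a_pos).2 ⟨0, by simp⟩
    simp only [(h.red_iterate_eq_iff hD D).2 rfl, lt_irrefl, if_false, add_zero, hr,
      Function.iterate_zero, id, h.γ_pos, if_true] at h1
    rw [h1, Finset.sum_boole, hd₁]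
    ring
  set Q : ℕ → ℝ := fun n => (step a δ γ σ)^[n] 0 with hQ
  have hitγ : hits a Q D γ - hits a Q D 0 = d₁ + 1 := by
    rw [hits_sub_zero h.a_pos h.γ_pos.le h.lt_a fun n _ => h.red_iterate_pos n,
      sum_ite_red_le (h.one_le hD) fun n _ => h.red_iterate_eq_iff hD (n + 1), hd₁]
  have hita : hits a Q D a = hits a Q D 0 + D := by
    simpa using hits_add_mul h.a_pos Q D 0 1
  have hitγ' : (hits a Q D γ : ℝ) = hits a Q D 0 + d₁ + 1 := by
    exact_mod_cast (by linarith : hits a Q D γ = hits a Q D 0 + d₁ + 1)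
  have hita' : (hits a Q D a : ℝ) = hits a Q D 0 + D := by exact_mod_cast hita
  -- `G` collapses the holes: up to normalization at 0 it removes δ for each right end of a hole
  -- passed. By `hits_lt` it stays strictly increasing from points of S, over at most one period.
  set G : ℝ → ℝ := fun x => x - δ * ((hits a Q D x : ℝ) - hits a Q D 0) with hG
  have hGlt : ∀ x ∈ S, ∀ x', x < x' → x' ≤ x + a → G x < G x' := by
    intro x hx x' h1 h2
    have := h.hits_lt hD hx h1 h2
    simp only [hG]; linarith
  have hG0 : G 0 = 0 := by simp [hG]
  have hGγ : G γ = γ - (d₁ + 1) * δ := by simp only [hG, hitγ']; ring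
  have hGa : G a = a - D * δ := by simp only [hG, hita']; ring
  have hGadd : ∀ (x : ℝ) (j : ℤ), G (x + j * a) = G x + j * (a - D * δ) := by
    intro x j
    simp only [hG, hits_add_mul h.a_pos]
    push_cast; ring
  -- The jumps of `step` cancel against the change of `hits`, leaving the constant displacement σ -
  -- mδ.
  have hGQ : ∀ n, G (Q n) = n * (σ - m * δ) := by
    intro n
    induction n with
    | zero => simpa [hQ] using hG0
    | succ n ih =>
      have hq : hits a Q D (step a δ γ σ (Q n)) = hits a Q D (Q n) + ⌊Q n / a⌋ -
          ⌊(Q n - γ) / a⌋ + m := h.hits_step hD (h.iterate_mem h.zero_mem n)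
      have hs : Q (n + 1) = step a δ γ σ (Q n) := Function.iterate_succ_apply' ..
      change Q n - δ * ((hits a Q D (Q n) : ℝ) - hits a Q D 0) = _ at ih
      change Q (n + 1) - δ * ((hits a Q D (Q (n + 1)) : ℝ) - hits a Q D 0) = _
      rw [hs, hq]
      unfold step
      push_cast
      linarith
  have h0γ := hGlt 0 h.zero_mem γ h.γ_pos (by linarith [h.lt_a])
  have hγa := hGlt γ h.γ_mem a h.lt_a (by linarith [h.γ_pos])
  rw [hG0, hGγ] at h0γ
  rw [hGγ, hGa] at hγa
  refine ⟨hsum, by linarith, by linarith, fun n hn => ?_⟩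
  set u := red a (Q (n + 1)) with hu
  have hu0 : 0 < u := h.red_iterate_pos n
  have hua : u < a := red_lt h.a_pos _
  have huS : u ∈ S := h.red_iterate_mem (n + 1)
  set j := ⌊Q (n + 1) / a⌋
  have hGu : ((n + 1 : ℕ) : ℝ) * (σ - m * δ) = G u + j * (a - D * δ) := by
    rw [← hGQ, ← hGadd]; congr 1; exact eq_red_add _
  have hGu0 := hGlt 0 h.zero_mem u hu0 (by linarith)
  have hGua := hGlt u huS a hua (by linarith)
  rw [hG0] at hGu0
  rw [hGa] at hGua
  rw [hGu]
  constructor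
  · rintro ⟨k, hk1, hk2⟩
    -- If u ≥ γ, then G u lies in [e, Y) with e = G γ and Y = G a, a range that misses [0, e) + Yℤ.
    by_contra! hle
    have hGe : G γ ≤ G u := by
      rcases hle.eq_or_lt with he | hl
      · exact he ▸ le_rfl
      · exact (hGlt γ h.γ_mem u hl (by linarith [h.γ_pos])).le
    rw [hGγ] at hGe
    have hY : 0 < a - D * δ := by linarith
    have h1 : (j : ℝ) < k := by
      by_contra! hc
      have := mul_le_mul_of_nonneg_right hc hY.le
      linarith
    have h2 : (j : ℝ) + 1 ≤ k := by exact_mod_cast h1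
    have := mul_le_mul_of_nonneg_right h2 hY.le
    linarith
  · intro hl
    have hGe := hGlt u huS γ hl (by linarith [h.lt_a])
    rw [hGγ] at hGe
    exact ⟨j, by linarith, by linarith⟩

end CircleSystem

/-! ### The matrix equation as a selection of lattice points -/

lemma finsum_ite_eq_one_iff (p : ℤ → Prop) [DecidablePred p] :
    ∑ᶠ n, (if p n then (1 : ℝ) else 0) = 1 ↔ ∃! n, p n := by
  constructor
  · intro hs
    obtain ⟨n, hn⟩ : ∃ n, p n := by
      by_contra! hne
      simp [hne] at hs
    refine ⟨n, hn, fun k hk => ?_⟩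
    by_contra hkn
    -- A `finsum` with infinite support is 0 by convention, so the value 1 forces finite support.
    have hfin : (Function.support fun n => if p n then (1 : ℝ) else 0).Finite := by
      by_contra hinf
      rw [finsum_of_infinite_support hinf] at hs
      exact zero_ne_one hs
    rw [finsum_eq_sum _ hfin] at hs
    have hsub : ({n, k} : Finset ℤ) ⊆ hfin.toFinset := by
      intro i hi
      rcases Finset.mem_insert.1 hi with rfl | hi
      · simpa using hn
      · rw [Finset.mem_singleton.1 hi]; simpa using hk
    have hle := Finset.sum_le_sum_of_subset_of_nonneg (f := fun n => if p n then (1 : ℝ) else 0)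
      hsub fun i _ _ => by positivity
    rw [Finset.sum_pair (Ne.symm hkn), if_pos hn, if_pos hk, hs] at hle
    norm_num at hle
  · rintro ⟨n, hn, huniq⟩
    rw [finsum_eq_single _ n fun k hk => if_neg fun h => hk (huniq k h), if_pos hn]

/-- X is the support of the binary vector: every window [ma, ma + c) contains exactly one point of t
+ bX. -/
lemma mem_maxInvariantSet_iff {a b c t : ℝ} : t ∈ maxInvariantSet a b c ↔
    ∃ X : Set ℤ, 0 ∈ X ∧ ∀ m : ℤ, ∃! n, n ∈ X ∧ m * a ≤ t + n * b ∧ t + n * b < m * a + c := by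
  classical
  have key : ∀ (x : ℤ → ℝ) (X : Set ℤ), (∀ n, x n = if n ∈ X then 1 else 0) → ∀ m : ℤ,
      (∑ᶠ n : ℤ, gaborMatrix a b c t m n * x n = 1 ↔
        ∃! n, n ∈ X ∧ m * a ≤ t + n * b ∧ t + n * b < m * a + c) := by
    intro x X hx m
    rw [← finsum_ite_eq_one_iff]
    refine Eq.congr (finsum_congr fun n => ?_) rfl
    have hI : t - m * a + n * b ∈ Set.Ico 0 c ↔ m * a ≤ t + n * b ∧ t + n * b < m * a + c := by
      rw [Set.mem_Ico]
      refine and_congr ?_ ?_ <;> constructor <;> intro _ <;> linarith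
    rw [hx, gaborMatrix, Matrix.of_apply, Set.indicator_apply]
    simp only [hI]
    by_cases h1 : n ∈ X <;> simp [h1]
  constructor
  · rintro ⟨x, ⟨h01, h0⟩, hx⟩
    refine ⟨{n | x n = 1}, h0, fun m => (key x _ (fun n => ?_) m).1 (hx m)⟩
    rcases h01 n with h | h <;> simp [h]
  · rintro ⟨X, h0, hX⟩
    refine ⟨fun n => if n ∈ X then 1 else 0, ⟨fun n => ?_, if_pos h0⟩,
      fun m => (key _ X (fun _ => rfl) m).2 (hX m)⟩
    by_cases h : n ∈ X <;> simp [h]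

lemma add_mul_mem_maxInvariantSet {a b c t : ℝ} (ht : t ∈ maxInvariantSet a b c) (j : ℤ) :
    t + j * a ∈ maxInvariantSet a b c := by
  rw [mem_maxInvariantSet_iff] at ht ⊢
  obtain ⟨X, h0, hX⟩ := ht
  refine ⟨X, h0, fun m => ?_⟩
  refine (existsUnique_congr fun n => ?_).1 (hX (m - j))
  push_cast
  refine and_congr_right fun _ => and_congr ?_ ?_ <;> constructor <;> intro _ <;> linarith

lemma int_mul_ne_of_irrational {a b : ℝ} (hb : b ≠ 0) (hirr : Irrational (a / b)) {p q : ℤ}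
    (hp : p ≠ 0) : (p : ℝ) * b ≠ q * a := by
  intro he
  have hq : (q : ℝ) ≠ 0 := by
    intro h0
    rw [h0, zero_mul] at he
    rcases mul_eq_zero.1 he with h | h
    · exact hp (by exact_mod_cast h)
    · exact hb h
  refine hirr ⟨(p : ℚ) / q, ?_⟩
  push_cast
  rw [div_eq_div_iff hq hb, he, mul_comm]

/-- The standing assumptions, with `γ = c₀` and `σ = c₁`. -/
structure Setting (a b c γ σ : ℝ) (K J : ℤ) : Prop where
  a_pos : 0 < a
  a_lt : a < b
  one_le : 1 ≤ K
  lt_γ : b - a < γ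
  γ_lt : γ < a
  c_eq : c = K * b + γ
  σ_eq : σ = K * b - J * a

/-! ### S as the largest invariant set -/

namespace Setting

variable {a b c γ σ : ℝ} {K J : ℤ} (h : Setting a b c γ σ K J)
include h

lemma γ_pos : 0 < γ := by linarith [h.lt_γ, h.a_lt]

lemma b_pos : 0 < b := h.a_pos.trans h.a_lt

lemma a_lt_c : a < c := by
  have h1 : (1 : ℝ) ≤ K := by exact_mod_cast h.one_le
  have := mul_le_mul_of_nonneg_right h1 h.b_pos.le
  linarith [h.c_eq, h.γ_pos, h.a_lt]

/-- The point selected by window m + 1 lies outside window m, hence in [ma + c, (m + 1)a + c). This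
interval is shorter than b, so the displacement can only be (K + 1)b below γ and Kb from γ on; in
the hole the former overshoots. -/
lemma successor {t : ℝ} {X : Set ℤ}
    (hX : ∀ m : ℤ, ∃! n, n ∈ X ∧ m * a ≤ t + n * b ∧ t + n * b < m * a + c)
    {n n' m : ℤ} (hn : n ∈ X) (h0 : m * a ≤ t + n * b) (h1 : t + n * b < (m + 1) * a)
    (hn' : n' ∈ X) (h0' : (m + 1) * a ≤ t + n' * b) (h1' : t + n' * b < (m + 1) * a + c) :
    (∃ l : ℤ, t + n' * b = step a (b - a) γ σ (t + n * b) + l * a) ∧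
      ∀ j : ℤ, γ - (b - a) + j * a ≤ t + n * b → γ + j * a ≤ t + n * b := by
  have ha := h.a_pos
  have hb := h.b_pos
  have hab := h.a_lt
  have hγ := h.lt_γ
  have hγa := h.γ_lt
  have hc := h.c_eq
  have hac := h.a_lt_c
  have hge : m * a + c ≤ t + n' * b := by
    by_contra! hlt
    have := (hX m).unique ⟨hn, h0, by linarith⟩ ⟨hn', by linarith, hlt⟩
    rw [← this] at h0'
    linarith
  have hm : ⌊(t + n * b) / a⌋ = m := (floor_div_eq ha m).2 ⟨h0, h1⟩
  have hred : red a (t + n * b) = t + n * b - m * a := by rw [red, hm]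
  have hstep := step_eq_of_red (δ := b - a) (σ := σ) ha h.γ_pos.le hγa (t + n * b)
  rw [hred] at hstep
  have hj : ∀ j : ℤ, γ - (b - a) + j * a ≤ t + n * b → γ + m * a ≤ t + n * b ∨ j ≠ m →
      γ + j * a ≤ t + n * b := by
    intro j hj1 hj2
    rcases lt_trichotomy j m with hl | rfl | hl
    · have : (j : ℝ) + 1 ≤ m := by exact_mod_cast hl
      have := mul_le_mul_of_nonneg_right this ha.le
      linarith
    · simpa using hj2
    · have : (m : ℝ) + 1 ≤ j := by exact_mod_cast hl
      have := mul_le_mul_of_nonneg_right this ha.le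
      linarith
  rcases lt_or_ge (t + n * b - m * a) γ with hs | hs
  · have hK : n' - n = K + 1 := by
      have e1 : (K : ℝ) < n' - n := by
        by_contra! hle
        have := mul_le_mul_of_nonneg_right hle hb.le
        linarith
      have e2 : ((n' : ℝ) - n) < K + 2 := by
        by_contra! hle
        have := mul_le_mul_of_nonneg_right hle hb.le
        linarith
      have e1' : K < n' - n := by exact_mod_cast e1
      have e2' : n' - n < K + 2 := by exact_mod_cast e2
      omega
    have hK' : (n' : ℝ) = n + K + 1 := by
      have : n' = n + K + 1 := by omega
      rw [this]; push_cast; ring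
    rw [if_pos hs] at hstep
    rw [hK'] at h1' ⊢
    refine ⟨⟨J + 1, ?_⟩, fun j hj1 => hj j hj1 (Or.inr ?_)⟩
    · rw [hstep, h.σ_eq]; push_cast; ring
    · rintro rfl
      linarith
  · have hK : n' - n = K := by
      have e1 : (K : ℝ) - 1 < n' - n := by
        by_contra! hle
        have := mul_le_mul_of_nonneg_right hle hb.le
        linarith
      have e2 : ((n' : ℝ) - n) < K + 1 := by
        by_contra! hle
        have := mul_le_mul_of_nonneg_right hle hb.le
        linarith
      have e1' : K - 1 < n' - n := by exact_mod_cast e1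
      have e2' : n' - n < K + 1 := by exact_mod_cast e2
      omega
    have hK' : (n' : ℝ) = n + K := by
      have : n' = n + K := by omega
      rw [this]; push_cast; ring
    rw [if_neg hs.not_gt] at hstep
    rw [hK']
    refine ⟨⟨J, ?_⟩, fun j hj1 => hj j hj1 (Or.inl (by linarith))⟩
    rw [hstep, h.σ_eq]; ring

omit h in
lemma shift_mem {t : ℝ} {X : Set ℤ}
    (hX : ∀ m : ℤ, ∃! n, n ∈ X ∧ m * a ≤ t + n * b ∧ t + n * b < m * a + c)
    {n : ℤ} (hn : n ∈ X) : t + n * b ∈ maxInvariantSet a b c := by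
  rw [mem_maxInvariantSet_iff]
  refine ⟨{k | k + n ∈ X}, by simpa using hn, fun m => ?_⟩
  obtain ⟨k, ⟨h1, h2, h3⟩, huniq⟩ := hX m
  refine ⟨k - n, ⟨by simpa using h1, by push_cast; linarith, by push_cast; linarith⟩, ?_⟩
  rintro l ⟨h4, h5, h6⟩
  have := huniq (l + n) ⟨h4, by push_cast; linarith, by push_cast; linarith⟩
  omega

lemma step_mem_and_avoid {t : ℝ} (ht : t ∈ maxInvariantSet a b c) :
    step a (b - a) γ σ t ∈ maxInvariantSet a b c ∧
      ∀ j : ℤ, γ - (b - a) + j * a ≤ t → γ + j * a ≤ t := by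
  obtain ⟨X, h0, hX⟩ := mem_maxInvariantSet_iff.1 ht
  obtain ⟨n', ⟨h1, h2, h3⟩, -⟩ := hX (⌊t / a⌋ + 1)
  push_cast at h2 h3
  have h4 := floor_div_mul_le h.a_pos t
  have h5 := lt_floor_div_add_one_mul h.a_pos t
  obtain ⟨⟨l, hl⟩, hav⟩ := h.successor hX h0 (by simpa using h4) (by simpa using h5) h1 h2 h3
  simp only [Int.cast_zero, zero_mul, add_zero] at hl hav
  refine ⟨?_, hav⟩
  have := add_mul_mem_maxInvariantSet (shift_mem hX h1) (-l)
  rw [hl] at this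
  push_cast at this
  ring_nf at this ⊢
  exact this

lemma exists_pre {t : ℝ} (ht : t ∈ maxInvariantSet a b c) :
    ∃ y ∈ maxInvariantSet a b c, step a (b - a) γ σ y = t := by
  obtain ⟨X, h0, hX⟩ := mem_maxInvariantSet_iff.1 ht
  -- With this m, window m + 1 contains t and window m ends at or before t, so the point selected by
  -- window m is the predecessor.
  set m := ⌊(t - c) / a⌋ with hm
  have hm1 := floor_div_mul_le h.a_pos (t - c)
  have hm2 := lt_floor_div_add_one_mul h.a_pos (t - c)
  rw [← hm] at hm1 hm2
  obtain ⟨n', ⟨h1, h2, h3⟩, -⟩ := hX m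
  have hac := h.a_lt_c
  have h4 : t + n' * b < (m + 1) * a := by
    by_contra! hle
    have : (0 : ℤ) = n' := (hX (m + 1)).unique
      ⟨h0, by push_cast; linarith, by push_cast; linarith⟩
      ⟨h1, by push_cast; linarith, by push_cast; linarith [h.a_pos]⟩
    rw [← this] at h3
    simp only [Int.cast_zero, zero_mul, add_zero] at h3
    linarith
  obtain ⟨⟨l, hl⟩, -⟩ := h.successor hX h1 h2 h4 h0 (by push_cast; linarith)
    (by push_cast; linarith)
  refine ⟨t + n' * b + l * a, add_mul_mem_maxInvariantSet (shift_mem hX h1) l, ?_⟩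
  rw [step_add_mul h.a_pos, ← hl]; simp

/-- The set is the largest one with its invariance properties. -/
theorem subset_maxInvariantSet {A : Set ℝ} (hper : ∀ x ∈ A, ∀ j : ℤ, x + j * a ∈ A)
    (hav : ∀ x ∈ A, ∀ j : ℤ, γ - (b - a) + j * a ≤ x → γ + j * a ≤ x)
    (hstep : ∀ x ∈ A, step a (b - a) γ σ x ∈ A)
    (hpre : ∀ x ∈ A, ∃ y ∈ A, step a (b - a) γ σ y = x) : A ⊆ maxInvariantSet a b c := by
  have ha := h.a_pos
  have hb := h.b_pos
  have hγ := h.lt_γ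
  have hγa := h.γ_lt
  have hγ0 := h.γ_pos
  have hab := h.a_lt
  set i : ℝ → ℤ := fun x => ⌊x / a⌋ - ⌊(x - γ) / a⌋ with hi
  have hi0 : ∀ x, 0 ≤ i x := fun x => sub_nonneg.2 (Int.floor_le_floor (by gcongr; linarith))
  have hT : ∀ x, x + (K + i x : ℤ) * b = step a (b - a) γ σ x + (J + i x : ℤ) * a := by
    intro x
    simp only [step, h.σ_eq, hi]
    push_cast; ring
  have hTA : ∀ x ∈ A, x + (K + i x : ℤ) * b ∈ A := fun x hx => by
    rw [hT]; exact hper _ (hstep x hx) _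
  have hiadd : ∀ (x : ℝ) (j : ℤ), i (x + j * a) = i x := by
    intro x j
    simp only [hi]
    rw [floor_add_mul_div ha, show x + j * a - γ = x - γ + j * a by ring, floor_add_mul_div ha]
    ring
  -- `T` agrees with `step` modulo a but moves by multiples of b. Being a bijection of A, it gives t
  -- a two-sided orbit inside t + bℤ, which serves as the selection.
  let T : A → A := fun x => ⟨x + (K + i x : ℤ) * b, hTA x x.2⟩
  have hinj : Function.Injective T := by
    rintro ⟨x, hx⟩ ⟨y, hy⟩ he
    have he' : x + (K + i x : ℤ) * b = y + (K + i y : ℤ) * b := congrArg Subtype.val he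
    have hs : x = y + (i y - i x : ℤ) * a := by
      have e : step a (b - a) γ σ x = step a (b - a) γ σ (y + (i y - i x : ℤ) * a) := by
        rw [hT, hT] at he'
        rw [step_add_mul ha]
        push_cast at he' ⊢
        linarith
      have hδ : 0 < b - a := sub_pos.2 h.a_lt
      rcases lt_trichotomy x (y + (i y - i x : ℤ) * a) with hl | hl | hl
      · exact absurd e (step_lt_step ha hδ (hγ.trans hγa) (hav x hx) hl).ne
      · exact hl
      · exact absurd e (step_lt_step ha hδ (hγ.trans hγa) (hav _ (hper y hy _)) hl).ne'
    have hxy : i x = i y := by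
      conv_lhs => rw [hs, hiadd]
    rw [hxy] at he'
    exact Subtype.ext (by simpa using he')
  have hsurj : Function.Surjective T := by
    rintro ⟨x, hx⟩
    obtain ⟨y, hy, rfl⟩ := hpre x hx
    refine ⟨⟨y + (-(J + i y) : ℤ) * a, hper y hy _⟩, Subtype.ext ?_⟩
    simp only [T]
    rw [hT, hiadd, step_add_mul ha]
    push_cast; ring
  let e : Equiv.Perm A := Equiv.ofBijective T ⟨hinj, hsurj⟩
  intro t ht
  let z : ℤ → ℝ := fun k => ((e ^ k) ⟨t, ht⟩ : A)
  have hzA : ∀ k, z k ∈ A := fun k => ((e ^ k) ⟨t, ht⟩ : A).2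
  have hz0 : z 0 = t := by simp [z]
  have hz : ∀ k, z (k + 1) = z k + (K + i (z k) : ℤ) * b := by
    intro k
    simp only [z]
    rw [add_comm k 1, zpow_one_add, Equiv.Perm.mul_apply]
    rfl
  -- Avoiding the hole says precisely that the successor lies past the window of index ⌊z k / a⌋ but
  -- inside the next one.
  have hwin : ∀ k, ⌊z k / a⌋ * a + c ≤ z (k + 1) ∧ z (k + 1) < (⌊z k / a⌋ + 1) * a + c := by
    intro k
    have h1 := floor_div_mul_le ha (z k)
    have h2 := lt_floor_div_add_one_mul ha (z k)
    have h3 := hav _ (hzA k) ⌊z k / a⌋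
    rw [hz, h.c_eq]
    simp only [hi]
    set m := ⌊z k / a⌋
    rcases lt_or_ge (z k) (γ + m * a) with hl | hl
    · have e2 : ⌊(z k - γ) / a⌋ = m - 1 :=
        (floor_div_eq ha _).2 ⟨by push_cast; linarith, by push_cast; linarith⟩
      have h4 : z k < γ - (b - a) + m * a := by
        by_contra! hle
        linarith [h3 hle]
      rw [e2]
      push_cast
      constructor <;> linarith
    · have e2 : ⌊(z k - γ) / a⌋ = m := (floor_div_eq ha _).2 ⟨by linarith, by linarith⟩
      rw [e2]
      push_cast
      constructor <;> linarith
  have hadd : ∀ k, z k + b ≤ z (k + 1) := by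
    intro k
    have h1 : (1 : ℝ) ≤ (K + i (z k) : ℤ) := by
      exact_mod_cast (by have := h.one_le; have := hi0 (z k); omega : 1 ≤ K + i (z k))
    have := mul_le_mul_of_nonneg_right h1 hb.le
    rw [hz]; linarith
  have hmono : StrictMono z := strictMono_int_of_lt_succ fun k => by linarith [hadd k]
  have hgrow : ∀ (k : ℤ) (n : ℕ), z k + n * b ≤ z (k + n) := by
    intro k n
    induction n with
    | zero => simp
    | succ n ih =>
      have := hadd (k + n)
      push_cast
      rw [← add_assoc]
      linarith
  have hlat : ∀ k, ∃ n : ℤ, z k = t + n * b := by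
    intro k
    induction k using Int.induction_on with
    | zero => exact ⟨0, by simp [hz0]⟩
    | succ k ih =>
      obtain ⟨n, hn⟩ := ih
      exact ⟨n + (K + i (z k)), by rw [hz, hn]; push_cast; ring⟩
    | pred k ih =>
      obtain ⟨n, hn⟩ := ih
      have := hz (-k - 1)
      rw [sub_add_cancel, hn] at this
      exact ⟨n - (K + i (z (-k - 1))), by push_cast at this ⊢; linarith⟩
  rw [mem_maxInvariantSet_iff]
  refine ⟨{n | ∃ k, z k = t + n * b}, ⟨0, by simp [hz0]⟩, fun m => ?_⟩
  -- If z k is the last orbit point before ma, then z (k + 1) is in window m and z (k + 2) is beyond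
  -- it.
  obtain ⟨k, hk, hkmax⟩ : ∃ k, z k < m * a ∧ ∀ l, z l < m * a → l ≤ k := by
    apply Int.exists_greatest_of_bdd
    · obtain ⟨N, hN⟩ := exists_nat_gt ((m * a - z 0) / b)
      rw [div_lt_iff₀ hb] at hN
      refine ⟨N, fun l hl => ?_⟩
      by_contra! hlt
      have h1 := hgrow 0 N
      have h2 := hmono hlt
      rw [zero_add] at h1
      linarith
    · obtain ⟨N, hN⟩ := exists_nat_gt ((z 0 - m * a) / b)
      rw [div_lt_iff₀ hb] at hN
      refine ⟨-N, ?_⟩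
      have h1 := hgrow (-N) N
      rw [neg_add_cancel] at h1
      linarith
  have hk1 : m * a ≤ z (k + 1) := by
    by_contra! hlt
    have := hkmax _ hlt
    omega
  obtain ⟨n, hn⟩ := hlat (k + 1)
  have hk2 : z (k + 1) < m * a + c := by
    have h1 : (⌊z k / a⌋ : ℝ) < m := by
      have := floor_div_mul_le ha (z k)
      exact lt_of_mul_lt_mul_right (this.trans_lt hk) ha.le
    have h2 : (⌊z k / a⌋ : ℝ) + 1 ≤ m := by exact_mod_cast h1
    have := mul_le_mul_of_nonneg_right h2 ha.le
    linarith [(hwin k).2]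
  refine ⟨n, ⟨⟨k + 1, hn⟩, by rw [← hn]; exact hk1, by rw [← hn]; exact hk2⟩, ?_⟩
  rintro n' ⟨⟨l, hl⟩, h1, h2⟩
  rw [← hl] at h1 h2
  have hkl : k < l := hmono.lt_iff_lt.1 (hk.trans_le h1)
  have hlk : l < k + 1 + 1 := by
    refine hmono.lt_iff_lt.1 (h2.trans_le ?_)
    have h3 : (m : ℝ) ≤ ⌊z (k + 1) / a⌋ := by
      exact_mod_cast Int.le_floor.2 ((le_div_iff₀ ha).2 hk1)
    have := mul_le_mul_of_nonneg_right h3 ha.le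
    linarith [(hwin (k + 1)).1]
  have : l = k + 1 := by omega
  rw [this, hn] at hl
  have := mul_right_cancel₀ hb.ne' (add_left_cancel hl)
  exact_mod_cast this.symm

omit h in
lemma exists_step_right {δ : ℝ} (ha : 0 < a) (x : ℝ) : ∃ ε > 0, ∀ s, x ≤ s → s < x + ε →
    step a δ γ σ s = step a δ γ σ x + (s - x) := by
  have h1 := floor_div_mul_le ha x
  have h2 := lt_floor_div_add_one_mul ha x
  have h3 := floor_div_mul_le ha (x - γ)
  have h4 := lt_floor_div_add_one_mul ha (x - γ)
  refine ⟨min ((⌊x / a⌋ + 1) * a - x) ((⌊(x - γ) / a⌋ + 1) * a - (x - γ)),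
    lt_min (by linarith) (by linarith), fun s hs hlt => ?_⟩
  have h5 := min_le_left ((⌊x / a⌋ + 1) * a - x) ((⌊(x - γ) / a⌋ + 1) * a - (x - γ))
  have h6 := min_le_right ((⌊x / a⌋ + 1) * a - x) ((⌊(x - γ) / a⌋ + 1) * a - (x - γ))
  have e1 : ⌊s / a⌋ = ⌊x / a⌋ := (floor_div_eq ha _).2 ⟨by linarith, by linarith⟩
  have e2 : ⌊(s - γ) / a⌋ = ⌊(x - γ) / a⌋ := (floor_div_eq ha _).2 ⟨by linarith, by linarith⟩
  unfold step
  rw [e1, e2]; ring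

/-- By maximality it suffices that the set of limits from the right has the same invariance
properties; these pass to limits because `step` is right-continuous. -/
lemma right_closed {x : ℝ} (hx : ∀ ε > 0, ∃ s ∈ maxInvariantSet a b c, x ≤ s ∧ s < x + ε) :
    x ∈ maxInvariantSet a b c := by
  set A := {x : ℝ | ∀ ε > 0, ∃ s ∈ maxInvariantSet a b c, x ≤ s ∧ s < x + ε} with hA
  suffices A ⊆ maxInvariantSet a b c from this hx
  clear hx x
  apply h.subset_maxInvariantSet
  · intro x hx j ε hε
    obtain ⟨s, hs, h1, h2⟩ := hx ε hε
    exact ⟨s + j * a, add_mul_mem_maxInvariantSet hs j, by linarith, by linarith⟩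
  · intro x hx j hj
    by_contra! hlt
    obtain ⟨s, hs, h1, h2⟩ := hx (γ + j * a - x) (by linarith)
    have := (h.step_mem_and_avoid hs).2 j (by linarith)
    linarith
  · intro x hx ε hε
    obtain ⟨ε₀, hε₀, hst⟩ := exists_step_right (γ := γ) (σ := σ) (δ := b - a) h.a_pos x
    obtain ⟨s, hs, h1, h2⟩ := hx (min ε ε₀) (lt_min hε hε₀)
    have h3 := min_le_left ε ε₀
    have h4 := min_le_right ε ε₀
    refine ⟨_, (h.step_mem_and_avoid hs).1, ?_, ?_⟩ <;> rw [hst s h1 (by linarith)] <;> linarith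
  · intro x hx
    -- Preimages of the approximating points are displaced by σ + δ or by σ; one of the two occurs
    -- arbitrarily close to x.
    obtain ⟨i, hi⟩ : ∃ i : ℝ, ∀ ε > 0, ∃ y ∈ maxInvariantSet a b c,
        step a (b - a) γ σ y = y + σ + i ∧ x - σ - i ≤ y ∧ y < x - σ - i + ε := by
      by_contra! hcon
      obtain ⟨ε₁, hε₁, hc₁⟩ := hcon ((b - a) * 1)
      obtain ⟨ε₀, hε₀, hc₀⟩ := hcon ((b - a) * 0)
      obtain ⟨s, hs, h1, h2⟩ := hx (min ε₁ ε₀) (lt_min hε₁ hε₀)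
      have h3 := min_le_left ε₁ ε₀
      have h4 := min_le_right ε₁ ε₀
      obtain ⟨y, hy, rfl⟩ := h.exists_pre hs
      have hst := step_eq_of_red (δ := b - a) (σ := σ) h.a_pos h.γ_pos.le h.γ_lt y
      split_ifs at hst
      · have := hc₁ y hy hst (by linarith)
        linarith
      · have := hc₀ y hy hst (by linarith)
        linarith
    refine ⟨x - σ - i, fun ε hε => ?_, ?_⟩
    · obtain ⟨y, hy, -, h1, h2⟩ := hi ε hε
      exact ⟨y, hy, h1, h2⟩
    · obtain ⟨ε₀, hε₀, hst⟩ :=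
        exists_step_right (γ := γ) (σ := σ) (δ := b - a) h.a_pos (x - σ - i)
      obtain ⟨y, hy, h0, h1, h2⟩ := hi ε₀ hε₀
      have := hst y h1 h2
      linarith

/-- The bound k ≤ N is what matters: the coefficient of b is nonzero for k > 0, so irrationality
excludes a return modulo a. -/
lemma iterate_step (k : ℕ) (x : ℝ) :
    ∃ N M : ℤ, k ≤ N ∧ (step a (b - a) γ σ)^[k] x = x + N * b + M * a := by
  induction k with
  | zero => exact ⟨0, 0, le_rfl, by simp⟩
  | succ k ih =>
    obtain ⟨N, M, hN, he⟩ := ih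
    rw [Function.iterate_succ_apply', he]
    set y := x + N * b + M * a with hy
    have hi : ⌊(y - γ) / a⌋ ≤ ⌊y / a⌋ :=
      Int.floor_le_floor (by have := h.a_pos; gcongr; linarith [h.γ_pos])
    have hK := h.one_le
    refine ⟨N + K + (⌊y / a⌋ - ⌊(y - γ) / a⌋), M - J - (⌊y / a⌋ - ⌊(y - γ) / a⌋),
      by push_cast; omega, ?_⟩
    rw [step, h.σ_eq]
    generalize ⌊y / a⌋ - ⌊(y - γ) / a⌋ = i
    rw [hy]
    push_cast; ring

lemma aperiodic (hirr : Irrational (a / b)) (x : ℝ) (k : ℕ) (j : ℤ) (hk : 0 < k) :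
    (step a (b - a) γ σ)^[k] x ≠ x + j * a := by
  obtain ⟨N, M, hN, he⟩ := h.iterate_step k x
  rw [he]
  intro hcon
  have hNb : (N : ℝ) * b = (j - M : ℤ) * a := by push_cast; linarith
  have hN0 : (N : ℝ) ≠ 0 := by
    have : N ≠ 0 := by omega
    exact_mod_cast this
  exact int_mul_ne_of_irrational h.b_pos.ne' hirr (by exact_mod_cast hN0) hNb

theorem circleSystem (hirr : Irrational (a / b)) (hne : (maxInvariantSet a b c).Nonempty) :
    CircleSystem a (b - a) γ σ (maxInvariantSet a b c) where
  a_pos := h.a_pos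
  δ_pos := sub_pos.2 h.a_lt
  δ_lt := h.lt_γ
  lt_a := h.γ_lt
  nonempty := hne
  periodic _ hx j := add_mul_mem_maxInvariantSet hx j
  avoid _ hx := (h.step_mem_and_avoid hx).2
  step_mem _ hx := (h.step_mem_and_avoid hx).1
  exists_pre _ hx := h.exists_pre hx
  right_closed _ hx := h.right_closed hx
  aperiodic := h.aperiodic hirr

end Setting

/-! ### Opening holes in a rotation -/

lemma exists_sub_mul_mem_Ico_iff {Y e x : ℝ} (hY : 0 < Y) (heY : e ≤ Y) :
    (∃ k : ℤ, x - k * Y ∈ Set.Ico 0 e) ↔ red Y x < e := by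
  constructor
  · rintro ⟨k, hk1, hk2⟩
    rwa [(red_eq_iff hY hk1 (hk2.trans_le heY)).2 ⟨k, by ring⟩]
  · exact fun hlt => ⟨⌊x / Y⌋, red_nonneg hY x, hlt⟩

lemma hits_lt_hits {a : ℝ} (ha : 0 < a) (Q : ℕ → ℝ) {D i : ℕ} (hi : i < D) {x y : ℝ} {l : ℤ}
    (hy : y = Q (i + 1) + l * a) (hxy : x < y) : hits a Q D x < hits a Q D y := by
  refine Finset.sum_lt_sum (fun n _ => Int.floor_le_floor (by gcongr))
    ⟨i, Finset.mem_range.2 hi, ?_⟩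
  have : ⌊(y - Q (i + 1)) / a⌋ = l := (floor_div_eq ha l).2 ⟨by linarith, by linarith⟩
  rw [this, Int.floor_lt, div_lt_iff₀ ha]
  linarith

/-- A rotation by `θ` of a circle of length `Y = a - D δ`, with holes of length `δ` opened at
`θ, 2 θ, …, D θ`, is the restriction of `step` to a subset of the circle of length `a`. -/
theorem exists_conjugacy {a δ γ σ : ℝ} {D d₁ : ℕ} {m : ℤ} (ha : 0 < a) (hδ : 0 < δ) (hD : 1 ≤ D)
    (hsum : D * σ + (d₁ + 1) * δ = γ + m * a) (he0 : (d₁ + 1) * δ < γ)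
    (heY : γ < a - (D - (d₁ + 1)) * δ)
    (hne : ∀ (n : ℕ) (k : ℤ), 1 ≤ n → (n : ℝ) * (σ - m * δ) ≠ k * (a - D * δ))
    (hcard : ((Finset.range D).filter fun n =>
      red (a - D * δ) ((n + 1 : ℕ) * (σ - m * δ)) < γ - (d₁ + 1) * δ).card = d₁) :
    ∃ f : ℝ → ℝ, StrictMono f ∧ f 0 = 0 ∧ f (γ - (d₁ + 1) * δ) = γ ∧
      (∀ y, ∀ j : ℤ, f (y + j * (a - D * δ)) = f y + j * a) ∧
      (∀ y, ∀ j : ℤ, γ - δ + j * a ≤ f y → γ + j * a ≤ f y) ∧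
      ∀ y, step a δ γ σ (f y) = f (y + (σ - m * δ)) := by
  set Y := a - D * δ with hYdef
  set e := γ - (d₁ + 1) * δ with hedef
  set θ := σ - m * δ with hθdef
  have he : 0 < e := by linarith
  have heY' : e < Y := by linarith
  have hY : 0 < Y := he.trans heY'
  have hDθ : D * θ = e + m * Y := by
    rw [hedef, hYdef, hθdef]; linarith
  set Q : ℕ → ℝ := fun n => n * θ with hQ
  have hpos : ∀ n < D, 0 < red Y (Q (n + 1)) := by
    refine fun n _ => (red_nonneg hY _).lt_of_ne' fun h0 => ?_
    obtain ⟨j, hj⟩ := (red_eq_iff hY le_rfl hY).1 h0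
    exact hne (n + 1) j (by omega) (by rw [zero_add] at hj; exact hj)
  have hQe : ∀ n < D, red Y (Q (n + 1)) = e ↔ n + 1 = D := by
    intro n hn
    rw [red_eq_iff hY he.le heY']
    constructor
    · rintro ⟨j, hj⟩
      -- Two times at e would differ by a positive n with nθ ∈ Yℤ.
      by_contra hnD
      refine hne (D - (n + 1)) (m - j) (by omega) ?_
      rw [Nat.cast_sub (by omega)]
      simp only [hQ] at hj
      push_cast at hj ⊢
      linarith
    · rintro rfl; exact ⟨m, hDθ⟩
  have hhit : hits Y Q D e - hits Y Q D 0 = d₁ + 1 := by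
    rw [hits_sub_zero hY he.le heY' hpos, sum_ite_red_le hD hQe, hcard]
  have hhit' : (hits Y Q D e : ℝ) - hits Y Q D 0 = d₁ + 1 := by exact_mod_cast hhit
  have hrot : ∀ y, hits Y Q D (y + θ) = hits Y Q D y + ⌊y / Y⌋ - ⌊(y - e) / Y⌋ + m := by
    intro y
    have hs := sum_range_add_eq (fun n => ⌊(y - Q n) / Y⌋) D
    have h1 : hits Y Q D (y + θ) = ∑ n ∈ Finset.range D, ⌊(y - Q n) / Y⌋ :=
      Finset.sum_congr rfl fun n _ => by
        congr 2
        simp only [hQ]; push_cast; ring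
    have h2 : ⌊(y - Q D) / Y⌋ = ⌊(y - e) / Y⌋ - m := by
      rw [show y - Q D = y - e + (-m : ℤ) * Y by simp only [hQ, hDθ]; push_cast; ring,
        floor_add_mul_div hY]; ring
    have h3 : Q 0 = 0 := by simp [hQ]
    rw [h2, h3, sub_zero] at hs
    rw [h1]
    unfold hits
    linarith
  -- The reverse of collapsing: δ is inserted at each translate of θ, …, Dθ.
  set f : ℝ → ℝ := fun y => y + δ * ((hits Y Q D y : ℝ) - hits Y Q D 0) with hf
  have hmono : StrictMono f := by
    intro x y hxy
    have : (hits Y Q D x : ℝ) ≤ hits Y Q D y := by exact_mod_cast hits_mono hY Q D hxy.le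
    have := mul_le_mul_of_nonneg_left this hδ.le
    simp only [hf]; linarith
  have hf0 : f 0 = 0 := by simp [hf]
  have hfe : f e = γ := by simp only [hf, hhit']; rw [hedef]; ring
  have hadd : ∀ (y : ℝ) (j : ℤ), f (y + j * Y) = f y + j * a := by
    intro y j
    simp only [hf, hits_add_mul hY]
    push_cast
    rw [hYdef]; ring
  -- A translate of Dθ sits at e + jY, so `f` jumps there by at least δ; its range therefore misses
  -- the hole below γ + ja.
  have hlow : ∀ (y : ℝ) (j : ℤ), y < e + j * Y → f y < γ - δ + j * a := by
    intro y j hlt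
    have h1 : hits Y Q D y < hits Y Q D (e + j * Y) := by
      refine hits_lt_hits hY Q (i := D - 1) (l := j - m) (by omega) ?_ hlt
      rw [Nat.sub_add_cancel hD]
      simp only [hQ, hDθ]; push_cast; ring
    have h2 : (hits Y Q D y : ℝ) + 1 ≤ hits Y Q D (e + j * Y) := by exact_mod_cast h1
    have h3 := hadd e j
    rw [hfe] at h3
    have := mul_le_mul_of_nonneg_left h2 hδ.le
    simp only [hf] at h3 ⊢
    linarith
  have hhigh : ∀ (y : ℝ) (j : ℤ), e + j * Y ≤ y → γ + j * a ≤ f y := by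
    intro y j hle
    rw [← hfe, ← hadd]
    exact hmono.monotone hle
  refine ⟨f, hmono, hf0, hfe, hadd, fun y j hj => hhigh y j ?_, fun y => ?_⟩
  · by_contra! hlt
    exact absurd (hlow y j hlt) hj.not_gt
  -- `f` takes the break points jY and e + jY of the rotation to ja and γ + ja, so both floors in
  -- `step` can be read off before opening the holes.
  · have e1 : ⌊f y / a⌋ = ⌊y / Y⌋ := by
      have h1 := hmono.monotone (floor_div_mul_le hY y)
      have h2 := hmono (lt_floor_div_add_one_mul hY y)
      have h3 := hadd 0 ⌊y / Y⌋
      have h4 := hadd 0 (⌊y / Y⌋ + 1)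
      push_cast at h4
      rw [zero_add, hf0, zero_add] at h3 h4
      exact (floor_div_eq ha _).2 ⟨by linarith, by linarith⟩
    have e2 : ⌊(f y - γ) / a⌋ = ⌊(y - e) / Y⌋ := by
      have h1 := floor_div_mul_le hY (y - e)
      have h2 := lt_floor_div_add_one_mul hY (y - e)
      have h3 := hhigh y ⌊(y - e) / Y⌋ (by linarith)
      have h4 := hlow y (⌊(y - e) / Y⌋ + 1) (by push_cast; linarith)
      push_cast at h4
      exact (floor_div_eq ha _).2 ⟨by linarith, by linarith⟩
    rw [step, e1, e2]
    simp only [hf, hrot]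
    push_cast
    linarith

namespace Setting

variable {a b c γ σ : ℝ} {K J : ℤ} (h : Setting a b c γ σ K J)
include h

/-- A relation nθ = kY is an integer relation between a and b, so both coefficients vanish and k =
n(K - J). Then θ ∈ Yℤ, hence e = Dθ - mY is a multiple of Y, contrary to 0 < e < Y. -/
lemma rotation_ne (hirr : Irrational (a / b)) {D d₁ : ℕ} {m : ℤ}
    (hsum : D * σ + (d₁ + 1) * (b - a) = γ + m * a) (he0 : (d₁ + 1) * (b - a) < γ)
    (heY : γ < a - (D - (d₁ + 1)) * (b - a)) (n : ℕ) (k : ℤ) (hn : 1 ≤ n) :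
    (n : ℝ) * (σ - m * (b - a)) ≠ k * (a - D * (b - a)) := by
  intro he
  have hp : n * (K - m) + k * D = 0 := by
    by_contra hp
    refine int_mul_ne_of_irrational h.b_pos.ne' hirr (q := n * (J - m) + k * (1 + D)) hp ?_
    rw [h.σ_eq] at he
    push_cast
    linarith
  have hq : n * (J - m) + k * (1 + D) = 0 := by
    have hpr : (n : ℝ) * (K - m) + k * D = 0 := by exact_mod_cast hp
    have : ((n : ℝ) * (J - m) + k * (1 + D)) * a = 0 := by
      rw [h.σ_eq] at he
      linear_combination b * hpr - he
    exact_mod_cast (mul_eq_zero.1 this).resolve_right h.a_pos.ne'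
  have hk : k = n * (K - J) := by linarith
  have hY : 0 < a - D * (b - a) := by linarith
  have hn0 : (n : ℝ) ≠ 0 := by positivity
  have hθ : σ - m * (b - a) = (K - J) * (a - D * (b - a)) := by
    apply mul_left_cancel₀ hn0
    rw [he, hk]; push_cast; ring
  have hDθ : γ - (d₁ + 1) * (b - a) = (D * (K - J) - m : ℤ) * (a - D * (b - a)) := by
    push_cast
    linear_combination D * hθ - hsum
  generalize (D * (K - J) - m : ℤ) = i at hDθ
  have h1 : (0 : ℝ) < i := by
    by_contra! hle
    have := mul_le_mul_of_nonneg_right hle hY.le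
    linarith
  have h2 : (i : ℝ) < 1 := by
    by_contra! hle
    have := mul_le_mul_of_nonneg_right hle hY.le
    linarith
  have h1' : 0 < i := by exact_mod_cast h1
  have h2' : i < 1 := by exact_mod_cast h2
  omega

/-- The range of the conjugacy f is invariant and avoids the hole, so it lies in S. The orbit of 0
is f(nθ), and as f is increasing with f(e) = γ, its points below γ correspond to multiples of θ
below e. -/
theorem of_parameters (hirr : Irrational (a / b)) {D d₁ : ℕ} {m : ℤ} (hD : 1 ≤ D)
    (hsum : D * σ + (d₁ + 1) * (b - a) = γ + m * a) (he0 : (d₁ + 1) * (b - a) < γ)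
    (heY : γ < a - (D - (d₁ + 1)) * (b - a))
    (hcard : ((Finset.range D).filter fun n => red (a - D * (b - a))
      ((n + 1 : ℕ) * (σ - m * (b - a))) < γ - (d₁ + 1) * (b - a)).card = d₁) :
    0 ∈ maxInvariantSet a b c ∧ (step a (b - a) γ σ)^[D] 0 = γ + m * a ∧
      ((Finset.range D).filter fun n =>
        red a ((step a (b - a) γ σ)^[n + 1] 0) < γ).card = d₁ := by
  obtain ⟨f, hmono, hf0, hfe, hadd, hav, hstep⟩ := exists_conjugacy h.a_pos (sub_pos.2 h.a_lt) hD
    hsum he0 heY (h.rotation_ne hirr hsum he0 heY) hcard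
  have hsub : Set.range f ⊆ maxInvariantSet a b c := by
    apply h.subset_maxInvariantSet
    · rintro _ ⟨y, rfl⟩ j
      exact ⟨_, hadd y j⟩
    · rintro _ ⟨y, rfl⟩
      exact hav y
    · rintro _ ⟨y, rfl⟩
      exact ⟨_, (hstep y).symm⟩
    · rintro _ ⟨y, rfl⟩
      exact ⟨_, ⟨y - (σ - m * (b - a)), rfl⟩, by rw [hstep, sub_add_cancel]⟩
  set Y := a - D * (b - a) with hY
  set e := γ - (d₁ + 1) * (b - a) with he
  have heY' : e < Y := by linarith
  have hY0 : 0 < Y := by linarith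
  have hiter : ∀ n : ℕ, (step a (b - a) γ σ)^[n] 0 = f (n * (σ - m * (b - a))) := by
    intro n
    induction n with
    | zero => simp [hf0]
    | succ n ih =>
      rw [Function.iterate_succ_apply', ih, hstep]
      congr 1; push_cast; ring
  refine ⟨hsub ⟨0, hf0⟩, ?_, ?_⟩
  · rw [hiter, ← hfe, ← hadd]
    congr 1
    rw [hY, he]; linarith
  · rw [← hcard]
    congr 1
    refine Finset.filter_congr fun n _ => ?_
    rw [hiter]
    set x := ((n + 1 : ℕ) : ℝ) * (σ - m * (b - a))
    have h1 := hmono.monotone (red_nonneg hY0 x)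
    have h2 := hmono (red_lt hY0 x)
    have h3 := hadd 0 1
    rw [hf0] at h1 h3
    simp only [Int.cast_one, one_mul, zero_add] at h3
    have hred : red a (f x) = f (red Y x) := (red_eq_iff h.a_pos h1 (h2.trans_eq h3)).2
      ⟨⌊x / Y⌋, by rw [← hadd, ← eq_red_add]⟩
    rw [hred, ← hmono.lt_iff_lt (a := red Y x), hfe]

end Setting

/-! ### The arithmetic conditions in terms of the orbit of 0 -/

lemma encard_eSet {a b c : ℝ} {D d₁ d₂ : ℕ} {m : ℤ} (hD : D = d₁ + d₂ + 1)
    (hm : mParam a b c d₁ d₂ = m) (hY : 0 < a - D * (b - a))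
    (heY : c₀ b c - (d₁ + 1) * (b - a) ≤ a - D * (b - a)) :
    (eSet a b c d₁ d₂).encard = ((Finset.range D).filter fun n => red (a - D * (b - a))
      ((n + 1 : ℕ) * (c₁ a b c - m * (b - a))) < c₀ b c - (d₁ + 1) * (b - a)).card := by
  symm
  rw [← Set.encard_coe_eq_coe_finsetCard, ← (add_left_injective 1).encard_image]
  congr 1
  ext n
  have hDc : (d₁ : ℝ) + d₂ + 1 = D := by rw [hD]; push_cast; ring
  simp only [eSet, hm, hDc, Set.mem_ofPred_eq, exists_sub_mul_mem_Ico_iff hY heY, Set.mem_image,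
    Finset.coe_filter, Finset.mem_range]
  constructor
  · rintro ⟨i, ⟨h1, h2⟩, rfl⟩
    exact ⟨by omega, by omega, h2⟩
  · rintro ⟨h1, h2, h3⟩
    obtain ⟨i, rfl⟩ := Nat.exists_eq_add_of_le' h1
    exact ⟨i, ⟨by omega, h3⟩, rfl⟩

lemma setting {a b c : ℝ} (ha : 0 < a) (hab : a < b) (hfloor : 2 ≤ ⌊c / b⌋)
    (h1 : b - a < c₀ b c) (h2 : c₀ b c < a) :
    Setting a b c (c₀ b c) (c₁ a b c) ⌊c / b⌋ ⌊(c - c₀ b c) / a⌋ where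
  a_pos := ha
  a_lt := hab
  one_le := by omega
  lt_γ := h1
  γ_lt := h2
  c_eq := by unfold c₀; ring
  σ_eq := by unfold c₁ c₀; ring

/-- Modulo a, condition (1) says that D steps, of which d₁ + 1 include the extra δ, lead from 0 to
γ. -/
lemma sum_eq_iff {a b c : ℝ} {K J : ℤ} (h : Setting a b c (c₀ b c) (c₁ a b c) K J)
    (hK : ⌊c / b⌋ = K) {D d₁ d₂ : ℕ} (hD : D = d₁ + d₂ + 1) :
    (∃ k : ℤ, c - ((d₁ : ℝ) + 1) * ((⌊c / b⌋ : ℝ) + 1) * (b - a)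
      - ((d₂ : ℝ) + 1) * (⌊c / b⌋ : ℝ) * (b - a) = a * k) ↔
    ∃ m : ℤ, D * c₁ a b c + (d₁ + 1) * (b - a) = c₀ b c + m * a := by
  rw [hK]
  have hc := h.c_eq
  have hσ := h.σ_eq
  have hDc : (D : ℝ) = d₁ + d₂ + 1 := by rw [hD]; push_cast; ring
  have hid : c - ((d₁ : ℝ) + 1) * ((K : ℝ) + 1) * (b - a) - ((d₂ : ℝ) + 1) * K * (b - a) =
      c₀ b c - D * c₁ a b c - (d₁ + 1) * (b - a) + ((D + 1) * K - D * J) * a := by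
    rw [hσ, hDc]
    linear_combination hc
  rw [hid]
  constructor
  · rintro ⟨k, hk⟩
    exact ⟨(D + 1) * K - D * J - k, by push_cast; linarith⟩
  · rintro ⟨m, hm⟩
    exact ⟨(D + 1) * K - D * J - m, by push_cast; linarith⟩

lemma admissibleParams_iff {a b c : ℝ} {K J : ℤ} (h : Setting a b c (c₀ b c) (c₁ a b c) K J)
    (hK : ⌊c / b⌋ = K) {D d₁ d₂ : ℕ} (hD : D = d₁ + d₂ + 1) :
    AdmissibleParams a b c d₁ d₂ ↔ ∃ m : ℤ,
      D * c₁ a b c + (d₁ + 1) * (b - a) = c₀ b c + m * a ∧ (d₁ + 1) * (b - a) < c₀ b c ∧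
      c₀ b c < a - (D - (d₁ + 1)) * (b - a) ∧
      ((Finset.range D).filter fun n => red (a - D * (b - a))
        ((n + 1 : ℕ) * (c₁ a b c - m * (b - a))) < c₀ b c - (d₁ + 1) * (b - a)).card = d₁ := by
  have hDc : (D : ℝ) = d₁ + d₂ + 1 := by rw [hD]; push_cast; ring
  have hc := h.c_eq
  have hcb : (⌊c / b⌋ : ℝ) * b = c - c₀ b c := by rw [hK]; linarith
  have hmp : ∀ m : ℤ, D * c₁ a b c + (d₁ + 1) * (b - a) = c₀ b c + m * a →
      mParam a b c d₁ d₂ = m := by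
    intro m hm
    rw [mParam, div_eq_iff h.a_pos.ne', ← hDc]; linarith
  unfold AdmissibleParams
  rw [sum_eq_iff h hK hD, hcb, hDc]
  constructor
  · rintro ⟨⟨m, hm⟩, ⟨h1, h2⟩, h3⟩
    refine ⟨m, hm, by linarith, by linarith, ?_⟩
    rw [encard_eSet hD (hmp m (by rw [hDc]; exact hm)) (by rw [hDc]; linarith) (by rw [hDc]; linarith), hDc] at h3
    exact_mod_cast h3
  · rintro ⟨m, hm, h1, h2, h3⟩
    refine ⟨⟨m, hm⟩, ⟨by linarith, by linarith⟩, ?_⟩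
    rw [encard_eSet hD (hmp m (by rw [hDc]; exact hm)) (by rw [hDc]; linarith) (by rw [hDc]; linarith), hDc, h3]

end GaborABC

end

theorem mainTheorem11 (a b c : ℝ) (ha : 0 < a) (hab : a < b) (hbc : b < c)
    (hfloor : 2 ≤ ⌊c / b⌋)
    (hc₀_lower : b - a < GaborABC.c₀ b c) (hc₀_upper : GaborABC.c₀ b c < a)
    (hc₁_lower : 0 < GaborABC.c₁ a b c) (hc₁_upper : GaborABC.c₁ a b c < 2 * a - b)
    (hirr : Irrational (a / b)) :
    ((GaborABC.maxInvariantSet a b c).Nonempty ↔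
      ∃ d₁ d₂ : ℕ, GaborABC.AdmissibleParams a b c d₁ d₂) ∧
    ∀ d₁ d₂ : ℕ, GaborABC.AdmissibleParams a b c d₁ d₂ →
      (GaborABC.holesIn a b c (Set.Ico 0 (GaborABC.c₀ b c + a - b))).encard = d₁ ∧
      (GaborABC.holesIn a b c (Set.Ico (GaborABC.c₀ b c) a)).encard = d₂ := by
  open GaborABC in
  have h := setting ha hab hfloor hc₀_lower hc₀_upper
  refine ⟨⟨fun hne => ?_, ?_⟩, ?_⟩
  · have hS := h.circleSystem hirr hne
    obtain ⟨D, m, hD1, hD, -⟩ := hS.exists_iterate_eq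
    have hcount := card_filter_add_card_filter
      (Q := fun n => (step a (b - a) (c₀ b c) (c₁ a b c))^[n] 0) hD1 fun n _ => hS.red_iterate_eq_iff hD (n + 1)
    obtain ⟨h1, h2, h3, h4⟩ := hS.parameters rfl hD
    refine ⟨_, _, (admissibleParams_iff h rfl hcount.symm).2 ⟨m, h1, h2, h3, ?_⟩⟩
    congr 1
    refine Finset.filter_congr fun n hn => ?_
    rw [← h4 n (Finset.mem_range.1 hn), exists_sub_mul_mem_Ico_iff] <;> linarith
  · rintro ⟨d₁, d₂, hd⟩
    obtain ⟨m, h1, h2, h3, h4⟩ := (admissibleParams_iff h rfl rfl).1 hd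
    exact ⟨0, (h.of_parameters hirr (by omega) h1 h2 h3 h4).1⟩
  · intro d₁ d₂ hd
    obtain ⟨m, h1, h2, h3, h4⟩ := (admissibleParams_iff h rfl rfl).1 hd
    obtain ⟨h5, h6, h7⟩ := h.of_parameters hirr (by omega) h1 h2 h3 h4
    have hS := h.circleSystem hirr ⟨0, h5⟩
    -- Of the D = d₁ + d₂ + 1 orbit points, d₁ lie below γ and one at γ, which leaves d₂ above.
    have hcount := card_filter_add_card_filter
      (Q := fun n => (step a (b - a) (c₀ b c) (c₁ a b c))^[n] 0) (hS.one_le h6) fun n _ => hS.red_iterate_eq_iff h6 (n + 1)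
    have hl := hS.encard_holes_left h6
    have hr := hS.encard_holes_right h6
    rw [h7] at hl hcount
    rw [show c₀ b c + a - b = c₀ b c - (b - a) by ring]
    refine ⟨hl, hr.trans ?_⟩
    congr 1
    omega
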